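/- Consider a two-user discrete memoryless multiple access channel with state distributed at the transmitters (MAC-DSTx). It has finite state alphabets $\mathcal S_1,\mathcal S_2$, finite input alphabets $\mathcal X_1,\mathcal X_2$, a finite output alphabet $\mathcal Y$, a state pmf $W_{\mathbf S}$ on $\mathcal S=\mathcal S_1\times\mathcal S_2$, transition probabilities $W_{Y|\mathbf X\mathbf S}$, and cost functions $\kappa_j:\mathcal X_j\times\mathcal S_j\to[0,\infty)$, $j=1,2$. The states $\mathbf S_i=(S_{1i},S_{2i})$ are i.i.d. with pmf $W_{\mathbf S}$, there is no feedback, and encoder $j$ knows $S_j^n$ non-causally. Logarithms and entropies are to base $2$. A code of block length $n$ consists of message sets $\mathcal M_1,\mathcal M_2$ (finite, nonempty), encoders $e_j:\mathcal M_j\times\mathcal S_j^n\to\mathcal X_j^n$ and a decoder $d:\mathcal Y^n\to\mathcal M_1\times\mathcal M_2$. With uniformly distributed message pair, let $\bar\xi(e,d)$ be its average error probability (the probability that the decoded pair differs from the message pair) and $\tau_j(e_j)$ the expectation of $\frac1n\sum_{i=1}^n\kappa_j(X_{ji},S_{ji})$. A rate pair $(R_1,R_2)\in[0,\infty)^2$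 is achievable under the cost constraint $\tau=(\tau_1,\tau_2)\in[0,\infty)^2$ if for every $\eta>0$ there is $N(\eta)$ such that for every $n>N(\eta)$ there is a code of block length $n$ with $\frac1n\log|\mathcal M_j|\ge R_j-\eta$ and $\tau_j(e_j)\le\tau_j+\eta$ for $j=1,2$, and $\bar\xi(e,d)\le\eta$. The capacity region $\mathbb C(\tau)$ is the closure of the convex hull of the set of achievable rate pairs. Let $\mathbb D_f(\tau)$ be the collection of all pmfs $p_{\mathbf V\mathbf S\mathbf XY}$ on $\mathcal V^2\times\mathcal S\times\mathcal X\times\mathcal Y$ (with $\mathbf V=(V_1,V_2)$, $\mathcal X=\mathcal X_1\times\mathcal X_2$), where $\mathcal V$ is any finite field, such that: (i) $p_{\mathbf S}=W_{\mathbf S}$; (ii) $p_{Y|\mathbf X\mathbf S\mathbf V}=p_{Y|\mathbf X\mathbf S}=W_{Y|\mathbf X\mathbf S}$; (iii) for $\{j,k\}=\{1,2\}$, $p_{V_j|\mathbf SV_k}=p_{V_j|\mathbf S}=p_{V_j|S_j}$ and $p_{X_j|\mathbf S\mathbf VX_k}=p_{X_j|\mathbf S\mathbf V}=p_{X_j|S_jV_j}$;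 (iv) $p_{X_j|S_jV_j}$ takes values in $\{0,1\}$ for $j=1,2$; (v) $\mathbb E\,\kappa_j(X_j,S_j)\le\tau_j$ for $j=1,2$. (Identities of conditional pmfs are required where the conditioning event has positive probability.) For $p\in\mathbb D_f(\tau)$ let $$\beta_f(p)=\bigl\{(R_1,R_2)\in[0,\infty)^2:\ R_1+R_2\le\min\{H(V_1|S_1),H(V_2|S_2)\}-H(V_1\oplus V_2|Y)\bigr\},$$ where $\oplus$ is addition in $\mathcal V$, and let $\beta_f(\tau)$ be the closure of the convex hull of $\bigcup_{p\in\mathbb D_f(\tau)}\beta_f(p)$. Theorem. For every such channel and every $\tau\in[0,\infty)^2$, $\beta_f(\tau)\subseteq\mathbb C(\tau)$. -/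

import Mathlib

/-! Discrete memoryless two-user multiple access channel whose state is distributed at the
transmitters (MAC-DSTx). All logarithms of information quantities are to base two. Probability
mass functions on a finite set are points of `stdSimplex ℝ`. -/

noncomputable section

/-! ### Random variables on a finite probability space -/

section Information

variable {Ω α β : Type*} [Fintype Ω]

open scoped Classical in
/-- The pmf of the random variable `A` when the sample point has pmf `p`. -/
def law (p : Ω → ℝ) (A : Ω → α) (a : α) : ℝ :=
  ∑ ω, if A ω = a then p ω else 0

/-- The conditional pmf `p_{A|B}(a|b)`; meaningful only if `law p B b ≠ 0`. -/
def condLaw (p : Ω → ℝ) (A : Ω → α) (B : Ω → β) (a : α) (b : β) : ℝ :=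
  law p (fun ω => (A ω, B ω)) (a, b) / law p B b

/-- The conditional Shannon entropy `H(A|B)` in bits,
`-∑ p_{AB}(a,b) log₂ p_{A|B}(a|b)`. -/
def condEntropy [Fintype α] [Fintype β] (p : Ω → ℝ) (A : Ω → α) (B : Ω → β) : ℝ :=
  -∑ a, ∑ b, law p (fun ω => (A ω, B ω)) (a, b) * Real.logb 2 (condLaw p A B a b)

/-- The expectation of a real random variable. -/
def expect (p : Ω → ℝ) (Z : Ω → ℝ) : ℝ := ∑ ω, p ω * Z ω

end Information

/-! ### The channel, codes, achievability and the capacity region -/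

/-- The channel `(𝒮, W_𝐒, 𝒳, κ, 𝒴, W_{Y|𝐗𝐒})`: the state pmf, the transition probabilities
`W x₁ x₂ s₁ s₂ y` and the two cost functions. -/
structure MACDSTx (S₁ S₂ X₁ X₂ Y : Type*) [Fintype S₁] [Fintype S₂] [Fintype Y] where
  WS : S₁ × S₂ → ℝ
  WS_mem : WS ∈ stdSimplex ℝ (S₁ × S₂)
  W : X₁ → X₂ → S₁ → S₂ → Y → ℝ
  W_mem : ∀ x₁ x₂ s₁ s₂, W x₁ x₂ s₁ s₂ ∈ stdSimplex ℝ Y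
  κ₁ : X₁ → S₁ → ℝ
  κ₁_nonneg : ∀ x s, 0 ≤ κ₁ x s
  κ₂ : X₂ → S₂ → ℝ
  κ₂_nonneg : ∀ x s, 0 ≤ κ₂ x s

/-- A code of block length `n` with `M₁` and `M₂` messages. Encoder `j` knows the whole state
sequence `s_j` (and nothing about the other one). -/
structure MACCode (S₁ S₂ X₁ X₂ Y : Type*) (n M₁ M₂ : ℕ) where
  enc₁ : Fin M₁ → (Fin n → S₁) → (Fin n → X₁)
  enc₂ : Fin M₂ → (Fin n → S₂) → (Fin n → X₂)
  dec : (Fin n → Y) → Fin M₁ × Fin M₂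

namespace MACDSTx

variable {S₁ S₂ X₁ X₂ Y : Type*} [Fintype S₁] [Fintype S₂] [Fintype Y]

/-- The pmf of `S₁`. -/
def WS₁ (ch : MACDSTx S₁ S₂ X₁ X₂ Y) (s₁ : S₁) : ℝ := ∑ s₂, ch.WS (s₁, s₂)

/-- The pmf of `S₂`. -/
def WS₂ (ch : MACDSTx S₁ S₂ X₁ X₂ Y) (s₂ : S₂) : ℝ := ∑ s₁, ch.WS (s₁, s₂)

variable {n M₁ M₂ : ℕ}

/-- The error probability conditioned on the message pair `(m₁, m₂)`. -/
def errorProb (ch : MACDSTx S₁ S₂ X₁ X₂ Y) (c : MACCode S₁ S₂ X₁ X₂ Y n M₁ M₂)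
    (m₁ : Fin M₁) (m₂ : Fin M₂) : ℝ :=
  ∑ s₁ : Fin n → S₁, ∑ s₂ : Fin n → S₂, (∏ i, ch.WS (s₁ i, s₂ i)) *
    ∑ y : Fin n → Y, if c.dec y = (m₁, m₂) then 0 else
      ∏ i, ch.W (c.enc₁ m₁ s₁ i) (c.enc₂ m₂ s₂ i) (s₁ i) (s₂ i) (y i)

/-- The average error probability: the message pair is uniformly distributed. -/
def avgErrorProb (ch : MACDSTx S₁ S₂ X₁ X₂ Y) (c : MACCode S₁ S₂ X₁ X₂ Y n M₁ M₂) : ℝ :=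
  (∑ m₁, ∑ m₂, ch.errorProb c m₁ m₂) / ((M₁ : ℝ) * (M₂ : ℝ))

/-- The average cost to user 1 of transmitting the message `m₁`. -/
def cost₁ (ch : MACDSTx S₁ S₂ X₁ X₂ Y) (c : MACCode S₁ S₂ X₁ X₂ Y n M₁ M₂)
    (m₁ : Fin M₁) : ℝ :=
  ∑ s₁ : Fin n → S₁, (∏ i, ch.WS₁ (s₁ i)) * ((∑ i, ch.κ₁ (c.enc₁ m₁ s₁ i) (s₁ i)) / (n : ℝ))

/-- The average cost to user 2 of transmitting the message `m₂`. -/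
def cost₂ (ch : MACDSTx S₁ S₂ X₁ X₂ Y) (c : MACCode S₁ S₂ X₁ X₂ Y n M₁ M₂)
    (m₂ : Fin M₂) : ℝ :=
  ∑ s₂ : Fin n → S₂, (∏ i, ch.WS₂ (s₂ i)) * ((∑ i, ch.κ₂ (c.enc₂ m₂ s₂ i) (s₂ i)) / (n : ℝ))

/-- The average cost of the code to user 1. -/
def avgCost₁ (ch : MACDSTx S₁ S₂ X₁ X₂ Y) (c : MACCode S₁ S₂ X₁ X₂ Y n M₁ M₂) : ℝ :=
  (∑ m₁, ch.cost₁ c m₁) / (M₁ : ℝ)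

/-- The average cost of the code to user 2. -/
def avgCost₂ (ch : MACDSTx S₁ S₂ X₁ X₂ Y) (c : MACCode S₁ S₂ X₁ X₂ Y n M₁ M₂) : ℝ :=
  (∑ m₂, ch.cost₂ c m₂) / (M₂ : ℝ)

/-- The rate pair `R` is achievable under the cost constraints `τ`. -/
def Achievable (ch : MACDSTx S₁ S₂ X₁ X₂ Y) (R τ : ℝ × ℝ) : Prop :=
  0 ≤ R.1 ∧ 0 ≤ R.2 ∧ 0 ≤ τ.1 ∧ 0 ≤ τ.2 ∧
  ∀ η : ℝ, 0 < η → ∃ N : ℕ, ∀ n : ℕ, N < n →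
    ∃ (M₁ M₂ : ℕ) (c : MACCode S₁ S₂ X₁ X₂ Y n M₁ M₂),
      0 < M₁ ∧ 0 < M₂ ∧
      R.1 - η ≤ Real.logb 2 (M₁ : ℝ) / (n : ℝ) ∧
      R.2 - η ≤ Real.logb 2 (M₂ : ℝ) / (n : ℝ) ∧
      ch.avgErrorProb c ≤ η ∧
      ch.avgCost₁ c ≤ τ.1 + η ∧
      ch.avgCost₂ c ≤ τ.2 + η

/-- The capacity region: the closure of the convex hull of the achievable rate pairs. -/
def capacityRegion (ch : MACDSTx S₁ S₂ X₁ X₂ Y) (τ : ℝ × ℝ) : Set (ℝ × ℝ) :=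
  closure (convexHull ℝ {R | ch.Achievable R τ})

end MACDSTx

/-! ### Test channels and the rate region -/

/-- The values `(u, s, x, y)` of the tuple `(𝐔, 𝐒, 𝐗, Y)`. -/
abbrev Outcome (U S₁ S₂ X₁ X₂ Y : Type*) : Type _ :=
  (U × U) × (S₁ × S₂) × (X₁ × X₂) × Y

namespace Outcome

variable {U S₁ S₂ X₁ X₂ Y : Type*}

abbrev u₁ (ω : Outcome U S₁ S₂ X₁ X₂ Y) : U := ω.1.1
abbrev u₂ (ω : Outcome U S₁ S₂ X₁ X₂ Y) : U := ω.1.2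
abbrev s₁ (ω : Outcome U S₁ S₂ X₁ X₂ Y) : S₁ := ω.2.1.1
abbrev s₂ (ω : Outcome U S₁ S₂ X₁ X₂ Y) : S₂ := ω.2.1.2
abbrev x₁ (ω : Outcome U S₁ S₂ X₁ X₂ Y) : X₁ := ω.2.2.1.1
abbrev x₂ (ω : Outcome U S₁ S₂ X₁ X₂ Y) : X₂ := ω.2.2.1.2
abbrev y (ω : Outcome U S₁ S₂ X₁ X₂ Y) : Y := ω.2.2.2

/-- The pair `𝐔`. -/
abbrev u (ω : Outcome U S₁ S₂ X₁ X₂ Y) : U × U := ω.1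
/-- The state pair `𝐒`. -/
abbrev s (ω : Outcome U S₁ S₂ X₁ X₂ Y) : S₁ × S₂ := ω.2.1
/-- The input pair `𝐗`. -/
abbrev x (ω : Outcome U S₁ S₂ X₁ X₂ Y) : X₁ × X₂ := ω.2.2.1

end Outcome

section Region

variable {S₁ S₂ X₁ X₂ Y : Type*} [Fintype S₁] [Fintype S₂] [Fintype X₁] [Fintype X₂] [Fintype Y]

/-- `p` is a test channel for the cost constraints `τ`, with the finite auxiliary alphabet `U`.
Every identity between conditional pmfs is required where the finest conditioning event has
positive probability. -/
structure IsTestChannel {U : Type*} [Fintype U] (ch : MACDSTx S₁ S₂ X₁ X₂ Y) (τ : ℝ × ℝ)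
    (p : Outcome U S₁ S₂ X₁ X₂ Y → ℝ) : Prop where
  /-- `p` is a pmf. -/
  pmf : p ∈ stdSimplex ℝ (Outcome U S₁ S₂ X₁ X₂ Y)
  /-- `p_𝐒 = W_𝐒`. -/
  state : ∀ s, law p (fun ω => ω.s) s = ch.WS s
  /-- `p_{Y|𝐗𝐒𝐔} = W_{Y|𝐗𝐒}`. -/
  output_fine : ∀ (x : X₁ × X₂) (s : S₁ × S₂) (u : U × U) (y : Y),
    law p (fun ω => (ω.x, ω.s, ω.u)) (x, s, u) ≠ 0 →
      condLaw p (fun ω => ω.y) (fun ω => (ω.x, ω.s, ω.u)) y (x, s, u) = ch.W x.1 x.2 s.1 s.2 y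
  /-- `p_{Y|𝐗𝐒} = W_{Y|𝐗𝐒}`. -/
  output : ∀ (x : X₁ × X₂) (s : S₁ × S₂) (y : Y),
    law p (fun ω => (ω.x, ω.s)) (x, s) ≠ 0 →
      condLaw p (fun ω => ω.y) (fun ω => (ω.x, ω.s)) y (x, s) = ch.W x.1 x.2 s.1 s.2 y
  /-- `p_{U₁|𝐒U₂} = p_{U₁|𝐒}`. -/
  aux₁_fine : ∀ (u₁ u₂ : U) (s : S₁ × S₂), law p (fun ω => (ω.s, ω.u₂)) (s, u₂) ≠ 0 →
    condLaw p (fun ω => ω.u₁) (fun ω => (ω.s, ω.u₂)) u₁ (s, u₂) =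
      condLaw p (fun ω => ω.u₁) (fun ω => ω.s) u₁ s
  /-- `p_{U₁|𝐒} = p_{U₁|S₁}`. -/
  aux₁ : ∀ (u₁ : U) (s : S₁ × S₂), law p (fun ω => ω.s) s ≠ 0 →
    condLaw p (fun ω => ω.u₁) (fun ω => ω.s) u₁ s =
      condLaw p (fun ω => ω.u₁) (fun ω => ω.s₁) u₁ s.1
  /-- `p_{U₂|𝐒U₁} = p_{U₂|𝐒}`. -/
  aux₂_fine : ∀ (u₁ u₂ : U) (s : S₁ × S₂), law p (fun ω => (ω.s, ω.u₁)) (s, u₁) ≠ 0 →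
    condLaw p (fun ω => ω.u₂) (fun ω => (ω.s, ω.u₁)) u₂ (s, u₁) =
      condLaw p (fun ω => ω.u₂) (fun ω => ω.s) u₂ s
  /-- `p_{U₂|𝐒} = p_{U₂|S₂}`. -/
  aux₂ : ∀ (u₂ : U) (s : S₁ × S₂), law p (fun ω => ω.s) s ≠ 0 →
    condLaw p (fun ω => ω.u₂) (fun ω => ω.s) u₂ s =
      condLaw p (fun ω => ω.u₂) (fun ω => ω.s₂) u₂ s.2
  /-- `p_{X₁|𝐒𝐔X₂} = p_{X₁|𝐒𝐔}`. -/
  input₁_fine : ∀ (x₁ : X₁) (x₂ : X₂) (s : S₁ × S₂) (u : U × U),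
    law p (fun ω => (ω.s, ω.u, ω.x₂)) (s, u, x₂) ≠ 0 →
      condLaw p (fun ω => ω.x₁) (fun ω => (ω.s, ω.u, ω.x₂)) x₁ (s, u, x₂) =
        condLaw p (fun ω => ω.x₁) (fun ω => (ω.s, ω.u)) x₁ (s, u)
  /-- `p_{X₁|𝐒𝐔} = p_{X₁|S₁U₁}`. -/
  input₁ : ∀ (x₁ : X₁) (s : S₁ × S₂) (u : U × U), law p (fun ω => (ω.s, ω.u)) (s, u) ≠ 0 →
    condLaw p (fun ω => ω.x₁) (fun ω => (ω.s, ω.u)) x₁ (s, u) =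
      condLaw p (fun ω => ω.x₁) (fun ω => (ω.s₁, ω.u₁)) x₁ (s.1, u.1)
  /-- `p_{X₂|𝐒𝐔X₁} = p_{X₂|𝐒𝐔}`. -/
  input₂_fine : ∀ (x₁ : X₁) (x₂ : X₂) (s : S₁ × S₂) (u : U × U),
    law p (fun ω => (ω.s, ω.u, ω.x₁)) (s, u, x₁) ≠ 0 →
      condLaw p (fun ω => ω.x₂) (fun ω => (ω.s, ω.u, ω.x₁)) x₂ (s, u, x₁) =
        condLaw p (fun ω => ω.x₂) (fun ω => (ω.s, ω.u)) x₂ (s, u)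
  /-- `p_{X₂|𝐒𝐔} = p_{X₂|S₂U₂}`. -/
  input₂ : ∀ (x₂ : X₂) (s : S₁ × S₂) (u : U × U), law p (fun ω => (ω.s, ω.u)) (s, u) ≠ 0 →
    condLaw p (fun ω => ω.x₂) (fun ω => (ω.s, ω.u)) x₂ (s, u) =
      condLaw p (fun ω => ω.x₂) (fun ω => (ω.s₂, ω.u₂)) x₂ (s.2, u.2)
  /-- `p_{X₁|S₁U₁}` takes only the values `0` and `1`. -/
  det₁ : ∀ (x₁ : X₁) (s₁ : S₁) (u₁ : U), law p (fun ω => (ω.s₁, ω.u₁)) (s₁, u₁) ≠ 0 →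
    condLaw p (fun ω => ω.x₁) (fun ω => (ω.s₁, ω.u₁)) x₁ (s₁, u₁) ∈ ({0, 1} : Set ℝ)
  /-- `p_{X₂|S₂U₂}` takes only the values `0` and `1`. -/
  det₂ : ∀ (x₂ : X₂) (s₂ : S₂) (u₂ : U), law p (fun ω => (ω.s₂, ω.u₂)) (s₂, u₂) ≠ 0 →
    condLaw p (fun ω => ω.x₂) (fun ω => (ω.s₂, ω.u₂)) x₂ (s₂, u₂) ∈ ({0, 1} : Set ℝ)
  /-- `𝔼 κ₁(X₁,S₁) ≤ τ₁`. -/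
  cost₁ : expect p (fun ω => ch.κ₁ ω.x₁ ω.s₁) ≤ τ.1
  /-- `𝔼 κ₂(X₂,S₂) ≤ τ₂`. -/
  cost₂ : expect p (fun ω => ch.κ₂ ω.x₂ ω.s₂) ≤ τ.2

/-- The rate pairs `R ∈ [0,∞)²` with `R₁ + R₂ ≤ min {H(V₁|S₁), H(V₂|S₂)} - H(V₁ ⊕ V₂|Y)`. -/
def betaOf {V : Type*} [Field V] [Fintype V] (p : Outcome V S₁ S₂ X₁ X₂ Y → ℝ) : Set (ℝ × ℝ) :=
  {R | 0 ≤ R.1 ∧ 0 ≤ R.2 ∧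
    R.1 + R.2 ≤ min (condEntropy p (fun ω => ω.u₁) (fun ω => ω.s₁))
        (condEntropy p (fun ω => ω.u₂) (fun ω => ω.s₂)) -
      condEntropy p (fun ω => ω.u₁ + ω.u₂) (fun ω => ω.y)}

/-- The region `β_f(τ)`: the closure of the convex hull of the union of the sets `betaOf p` over
all finite fields `V` and all test channels `p` with auxiliary alphabet `V`. -/
def betaF (ch : MACDSTx S₁ S₂ X₁ X₂ Y) (τ : ℝ × ℝ) : Set (ℝ × ℝ) :=
  closure (convexHull ℝ {R | ∃ (V : Type) (_ : Field V) (_ : Fintype V)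
    (p : Outcome V S₁ S₂ X₁ X₂ Y → ℝ), IsTestChannel ch τ p ∧ R ∈ betaOf p})

end Region

end

/-! The receiver decodes only the sum of the two auxiliary words, and linear hashing makes that
enough. One random linear map `(h₀, h₁, h₂)` on `Vⁿ` hashes both words. User 1 carries its message
in the `h₁`-part of its hash, and its `h₀`- and `h₂`-parts are frozen at constants known to the
receiver; user 2 carries its message in the `h₂`-part, with the `h₀`- and `h₁`-parts frozen. By
linearity the receiver knows `h₀(V₁ⁿ ⊕ V₂ⁿ)`, a bin index from which, together with `Yⁿ`, it finds
the sum as soon as `h₀` has rate above `H(V₁ ⊕ V₂|Y)`. Subtracting the frozen constants from `h₁`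
and `h₂` of the sum yields both messages.

Encoder `j` draws its word from the memoryless conditional law given its state sequence, conditioned
further on the prescribed hash. If the hash were exactly uniform given the state, a uniform index
followed by this encoder would reproduce the i.i.d. law of the test channel. The leftover hash lemma
makes it nearly uniform while the total rate of `(h₀, h₁, h₂)` stays below `H(V_j|S_j)`. The rate
left for the messages is `min {H(V₁|S₁), H(V₂|S₂)} - H(V₁ ⊕ V₂|Y)`, to be split freely between the
users.

Randomness is removed by averaging: a linear cost is no larger for some deterministic encoders, some
seed and some frozen constants. The weight is carried by `exists_encoders` (replacing true hashes by
uniform indices), `leftover_hash`, `exists_binning_decoder` and their combination `exists_code`;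
Chebyshev's inequality turns the one-shot bound into entropies in `IsTestChannel.exists_block_code`.
-/

noncomputable section

/-! ### Finite laws and derandomization. -/

theorem law_nonneg {Ω α : Type*} [Fintype Ω] {p : Ω → ℝ} (hp : ∀ ω, 0 ≤ p ω) (A : Ω → α)
    (a : α) : 0 ≤ law p A a := by
  classical
  rw [law]
  exact Finset.sum_nonneg fun ω _ => by split_ifs <;> simp [hp]

/-- Change of variables: the expectation of `φ ∘ A` is the sum of `φ` against the law of `A`. -/
theorem sum_law_mul {Ω α : Type*} [Fintype Ω] [Fintype α] (p : Ω → ℝ) (A : Ω → α) (φ : α → ℝ) :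
    ∑ a, law p A a * φ a = ∑ ω, p ω * φ (A ω) := by
  classical
  simp only [law, Finset.sum_mul]
  rw [Finset.sum_comm]
  refine Finset.sum_congr rfl fun ω _ => ?_
  simp [ite_mul]

theorem sum_law {Ω α : Type*} [Fintype Ω] [Fintype α] (p : Ω → ℝ) (A : Ω → α) :
    ∑ a, law p A a = ∑ ω, p ω := by
  simpa using sum_law_mul p A fun _ => 1

theorem law_mem_stdSimplex {Ω α : Type*} [Fintype Ω] [Fintype α] {p : Ω → ℝ}
    (hp : p ∈ stdSimplex ℝ Ω) (A : Ω → α) : law p A ∈ stdSimplex ℝ α :=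
  ⟨law_nonneg hp.1 A, (sum_law p A).trans hp.2⟩

theorem law_law {Ω α β : Type*} [Fintype Ω] [Fintype α] (p : Ω → ℝ) (A : Ω → α) (f : α → β) :
    law (law p A) f = law p (fun ω => f (A ω)) := by
  classical
  ext b
  have := sum_law_mul p A fun a => if f a = b then 1 else 0
  simpa [law, mul_ite] using this

theorem exists_le_weighted_sum {B : Type*} [Fintype B] {k : B → ℝ} (hk : k ∈ stdSimplex ℝ B)
    (g : B → ℝ) : ∃ b, g b ≤ ∑ b, k b * g b := by
  by_contra! h
  have hne : ∃ b, k b ≠ 0 := by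
    by_contra! h0
    simpa [h0] using hk.2
  obtain ⟨b₀, hb₀⟩ := hne
  have : ∑ b, k b * (∑ b, k b * g b) < ∑ b, k b * g b :=
    Finset.sum_lt_sum (fun b _ => mul_le_mul_of_nonneg_left (h b).le (hk.1 b))
      ⟨b₀, Finset.mem_univ _, mul_lt_mul_of_pos_left (h b₀) ((hk.1 b₀).lt_of_ne' hb₀)⟩
  rw [← Finset.sum_mul, hk.2, one_mul] at this
  exact lt_irrefl _ this

/-- A stochastic map can be replaced by a deterministic one without increasing a linear cost. -/
theorem exists_map_le_weighted_sum {I B : Type*} [Fintype I] [Fintype B] {k : I → B → ℝ}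
    (hk : ∀ i, k i ∈ stdSimplex ℝ B) (g : I → B → ℝ) :
    ∃ f : I → B, ∑ i, g i (f i) ≤ ∑ i, ∑ b, k i b * g i b := by
  choose f hf using fun i => exists_le_weighted_sum (hk i) (g i)
  exact ⟨f, Finset.sum_le_sum fun i _ => hf i⟩

/-! ### Encoding from uniform indices instead of true hashes. -/

/-- The `ℓ¹` distance from uniform of the hash `h` of a random variable with pmf `a`. -/
def hashDist {B D : Type*} [Fintype B] [Fintype D] (a : B → ℝ) (h : B → D) : ℝ :=
  ∑ d, |law a h d - 1 / Fintype.card D|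

open scoped Classical in
/-- The conditional pmf of a `B`-valued variable with pmf `a` given the value of its hash. -/
def hashKernel {B D : Type*} [Fintype B] (a : B → ℝ) (h : B → D) (d : D) (b : B) : ℝ :=
  -- On a hash value of probability zero any pmf serves; an encoder is needed there too, because the
  -- uniform index takes every value.
  if law a h d = 0 then a b else (if h b = d then a b else 0) / law a h d

theorem hashKernel_mem {B D : Type*} [Fintype B] {a : B → ℝ} (ha : a ∈ stdSimplex ℝ B)
    (h : B → D) (d : D) : hashKernel a h d ∈ stdSimplex ℝ B := by
  classical
  by_cases h0 : law a h d = 0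
  · have : hashKernel a h d = a := by ext b; simp [hashKernel, h0]
    rwa [this]
  · refine ⟨fun b => ?_, ?_⟩
    · rw [hashKernel, if_neg h0]
      refine div_nonneg ?_ (law_nonneg ha.1 h d)
      split_ifs
      exacts [ha.1 b, le_rfl]
    · simp only [hashKernel, if_neg h0]
      rw [← Finset.sum_div, ← law, div_self h0]

open scoped Classical in
-- Bayes' rule, valid also for null hash values, since `a` then vanishes on the whole fibre. It
-- turns the kernel weighted by the true hash law back into `a`.
theorem law_mul_hashKernel {B D : Type*} [Fintype B] {a : B → ℝ} (ha : ∀ b, 0 ≤ a b)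
    (h : B → D) (d : D) (b : B) :
    law a h d * hashKernel a h d b = if h b = d then a b else 0 := by
  by_cases h0 : law a h d = 0
  · rw [h0, zero_mul]
    have := (Finset.sum_eq_zero_iff_of_nonneg (fun ω _ => by split_ifs <;> simp [ha])).1 h0 b
      (Finset.mem_univ b)
    exact this.symm
  · rw [hashKernel, if_neg h0, mul_div_cancel₀ _ h0]

/-- Hybrid argument: the two factors of the product are replaced by the uniform law one at a time.
-/
theorem sum_sum_abs_sub_le {D : Type*} [Fintype D] [Nonempty D] {a₁ a₂ : D → ℝ}
    (h₁ : a₁ ∈ stdSimplex ℝ D) :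
    ∑ d₁, ∑ d₂, |1 / (Fintype.card D : ℝ) * (1 / Fintype.card D) - a₁ d₁ * a₂ d₂| ≤
      ∑ d, |a₁ d - 1 / Fintype.card D| + ∑ d, |a₂ d - 1 / Fintype.card D| := by
  set u : ℝ := 1 / Fintype.card D with hu
  have hcard : (Fintype.card D : ℝ) * u = 1 := by
    rw [hu]; field_simp
  have hu0 : 0 ≤ u := by positivity
  calc ∑ d₁, ∑ d₂, |u * u - a₁ d₁ * a₂ d₂|
      ≤ ∑ d₁, ∑ d₂, (u * |a₁ d₁ - u| + a₁ d₁ * |a₂ d₂ - u|) := by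
        refine Finset.sum_le_sum fun d₁ _ => Finset.sum_le_sum fun d₂ _ => ?_
        have : u * u - a₁ d₁ * a₂ d₂ = -(u * (a₁ d₁ - u)) - a₁ d₁ * (a₂ d₂ - u) := by ring
        rw [this]
        refine (abs_sub _ _).trans ?_
        rw [abs_neg, abs_mul, abs_mul, abs_of_nonneg hu0, abs_of_nonneg (h₁.1 d₁)]
    _ = _ := by
        simp only [Finset.sum_add_distrib, ← Finset.mul_sum, ← Finset.sum_mul, Finset.sum_const,
          Finset.card_univ, nsmul_eq_mul, h₁.2, one_mul]
        rw [← mul_assoc, mul_comm u, hcard, one_mul]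

/-- The kernels are derandomized in turn: `f₁` against the cost averaged over `k₂`, then `f₂` with
`f₁` fixed. As the cost is a sum over `i` and `j`, each map may be chosen pointwise in its own
argument, so neither encoder sees the other's data. -/
theorem exists_map_map_le_weighted_sum {I J B₁ B₂ : Type*} [Fintype I] [Fintype J] [Fintype B₁]
    [Fintype B₂] {k₁ : I → B₁ → ℝ} (hk₁ : ∀ i, k₁ i ∈ stdSimplex ℝ B₁) {k₂ : J → B₂ → ℝ}
    (hk₂ : ∀ j, k₂ j ∈ stdSimplex ℝ B₂) (g : I → J → B₁ → B₂ → ℝ) :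
    ∃ (f₁ : I → B₁) (f₂ : J → B₂), ∑ i, ∑ j, g i j (f₁ i) (f₂ j) ≤
      ∑ i, ∑ j, ∑ b₁, ∑ b₂, k₁ i b₁ * k₂ j b₂ * g i j b₁ b₂ := by
  obtain ⟨f₁, hf₁⟩ := exists_map_le_weighted_sum hk₁ fun i b₁ =>
    ∑ j, ∑ b₂, k₂ j b₂ * g i j b₁ b₂
  obtain ⟨f₂, hf₂⟩ := exists_map_le_weighted_sum hk₂ fun j b₂ => ∑ i, g i j (f₁ i) b₂
  refine ⟨f₁, f₂, ?_⟩
  calc ∑ i, ∑ j, g i j (f₁ i) (f₂ j) = ∑ j, ∑ i, g i j (f₁ i) (f₂ j) := Finset.sum_comm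
    _ ≤ _ := hf₂
    _ = ∑ i, ∑ j, ∑ b₂, k₂ j b₂ * g i j (f₁ i) b₂ := by
        simp only [Finset.mul_sum]
        rw [Finset.sum_comm (γ := I)]
        exact Finset.sum_congr rfl fun j _ => Finset.sum_comm
    _ ≤ _ := hf₁
    _ = _ := by
        simp only [Finset.mul_sum, mul_assoc]
        exact Finset.sum_congr rfl fun i _ => Finset.sum_comm

theorem sum_comm₄ {S₁ S₂ D₁ D₂ : Type*} [Fintype S₁] [Fintype S₂] [Fintype D₁] [Fintype D₂]
    (f : D₁ → S₁ → D₂ → S₂ → ℝ) :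
    ∑ d₁, ∑ s₁, ∑ d₂, ∑ s₂, f d₁ s₁ d₂ s₂ = ∑ s₁, ∑ s₂, ∑ d₁, ∑ d₂, f d₁ s₁ d₂ s₂ := by
  rw [Finset.sum_comm]
  refine Finset.sum_congr rfl fun s₁ _ => ?_
  rw [Finset.sum_congr rfl fun d₁ _ => Finset.sum_comm]
  exact Finset.sum_comm

/-- Encoders which, averaged over uniform indices `d₁`, `d₂`, do almost as well as the memoryless
law under which `d₁`, `d₂` are the hashes of the auxiliary variables. -/
theorem exists_encoders {S₁ S₂ B₁ B₂ D : Type*} [Fintype S₁] [Fintype S₂] [Fintype B₁]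
    [Fintype B₂] [Fintype D] [Nonempty D] {W : S₁ → S₂ → ℝ} (hW : ∀ s₁ s₂, 0 ≤ W s₁ s₂)
    {A₁ : S₁ → B₁ → ℝ} (hA₁ : ∀ s, A₁ s ∈ stdSimplex ℝ B₁)
    {A₂ : S₂ → B₂ → ℝ} (hA₂ : ∀ s, A₂ s ∈ stdSimplex ℝ B₂) (h₁ : B₁ → D) (h₂ : B₂ → D)
    {g : D → D → S₁ → S₂ → B₁ → B₂ → ℝ} {C : ℝ}
    (hg0 : ∀ d₁ d₂ s₁ s₂ b₁ b₂, 0 ≤ g d₁ d₂ s₁ s₂ b₁ b₂)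
    (hgC : ∀ d₁ d₂ s₁ s₂ b₁ b₂, g d₁ d₂ s₁ s₂ b₁ b₂ ≤ C) :
    ∃ (f₁ : D → S₁ → B₁) (f₂ : D → S₂ → B₂),
      (1 / (Fintype.card D : ℝ) * (1 / Fintype.card D)) *
        (∑ s₁, ∑ s₂, ∑ d₁, ∑ d₂, W s₁ s₂ * g d₁ d₂ s₁ s₂ (f₁ d₁ s₁) (f₂ d₂ s₂)) ≤
      (∑ s₁, ∑ s₂, W s₁ s₂ * ∑ b₁, ∑ b₂, A₁ s₁ b₁ * A₂ s₂ b₂ *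
        g (h₁ b₁) (h₂ b₂) s₁ s₂ b₁ b₂) +
      C * (∑ s₁, ∑ s₂, W s₁ s₂ * hashDist (A₁ s₁) h₁ +
        ∑ s₁, ∑ s₂, W s₁ s₂ * hashDist (A₂ s₂) h₂) := by
  classical
  -- The argument of each kernel is the pair of index and local state, exactly what the encoder
  -- knows.
  set K₁ := fun (i : D × S₁) => hashKernel (A₁ i.2) h₁ i.1 with hK₁
  set K₂ := fun (i : D × S₂) => hashKernel (A₂ i.2) h₂ i.1 with hK₂
  have hK₁m : ∀ i, K₁ i ∈ stdSimplex ℝ B₁ := fun i => hashKernel_mem (hA₁ i.2) h₁ i.1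
  have hK₂m : ∀ i, K₂ i ∈ stdSimplex ℝ B₂ := fun i => hashKernel_mem (hA₂ i.2) h₂ i.1
  obtain ⟨f₁, f₂, hf⟩ := exists_map_map_le_weighted_sum hK₁m hK₂m fun i j b₁ b₂ =>
    W i.2 j.2 * g i.1 j.1 i.2 j.2 b₁ b₂
  refine ⟨fun d s => f₁ (d, s), fun d s => f₂ (d, s), ?_⟩
  simp only [Fintype.sum_prod_type] at hf
  rw [sum_comm₄ (f := fun d₁ s₁ d₂ s₂ => W s₁ s₂ * g d₁ d₂ s₁ s₂ (f₁ (d₁, s₁)) (f₂ (d₂, s₂))),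
    sum_comm₄ (f := fun d₁ s₁ d₂ s₂ => ∑ b₁, ∑ b₂, K₁ (d₁, s₁) b₁ * K₂ (d₂, s₂) b₂ *
      (W s₁ s₂ * g d₁ d₂ s₁ s₂ b₁ b₂))] at hf
  set u : ℝ := 1 / (Fintype.card D : ℝ) with hu
  have hu0 : 0 ≤ u := by positivity
  -- Passing from uniform weights to the true hash probabilities changes the mean cost by at most
  -- `C` times the difference of the weights, as the inner average `G` lies in `[0, C]`.
  have key : ∀ d₁ d₂ s₁ s₂, u * u * ∑ b₁, ∑ b₂, K₁ (d₁, s₁) b₁ * K₂ (d₂, s₂) b₂ *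
        g d₁ d₂ s₁ s₂ b₁ b₂ ≤
      (∑ b₁, ∑ b₂, (if h₁ b₁ = d₁ then A₁ s₁ b₁ else 0) * (if h₂ b₂ = d₂ then A₂ s₂ b₂ else 0) *
        g d₁ d₂ s₁ s₂ b₁ b₂) + C * |u * u - law (A₁ s₁) h₁ d₁ * law (A₂ s₂) h₂ d₂| := by
    intro d₁ d₂ s₁ s₂
    set G := ∑ b₁, ∑ b₂, K₁ (d₁, s₁) b₁ * K₂ (d₂, s₂) b₂ * g d₁ d₂ s₁ s₂ b₁ b₂ with hG
    have hG0 : 0 ≤ G := Finset.sum_nonneg fun b₁ _ => Finset.sum_nonneg fun b₂ _ =>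
      mul_nonneg (mul_nonneg ((hK₁m _).1 _) ((hK₂m _).1 _)) (hg0 ..)
    have hGC : G ≤ C := by
      calc G ≤ ∑ b₁, ∑ b₂, K₁ (d₁, s₁) b₁ * K₂ (d₂, s₂) b₂ * C :=
            Finset.sum_le_sum fun b₁ _ => Finset.sum_le_sum fun b₂ _ =>
              mul_le_mul_of_nonneg_left (hgC ..) (mul_nonneg ((hK₁m _).1 _) ((hK₂m _).1 _))
        _ = C := by
            simp only [← Finset.sum_mul, ← Finset.mul_sum, (hK₂m _).2, (hK₁m _).2, one_mul, mul_one]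
    have e : ∑ b₁, ∑ b₂, (if h₁ b₁ = d₁ then A₁ s₁ b₁ else 0) *
        (if h₂ b₂ = d₂ then A₂ s₂ b₂ else 0) * g d₁ d₂ s₁ s₂ b₁ b₂ =
        law (A₁ s₁) h₁ d₁ * law (A₂ s₂) h₂ d₂ * G := by
      simp only [hG, Finset.mul_sum]
      refine Finset.sum_congr rfl fun b₁ _ => Finset.sum_congr rfl fun b₂ _ => ?_
      rw [← law_mul_hashKernel (hA₁ s₁).1, ← law_mul_hashKernel (hA₂ s₂).1]
      ring
    rw [e]
    have : (u * u - law (A₁ s₁) h₁ d₁ * law (A₂ s₂) h₂ d₂) * G ≤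
        |u * u - law (A₁ s₁) h₁ d₁ * law (A₂ s₂) h₂ d₂| * C :=
      (mul_le_mul_of_nonneg_right (le_abs_self _) hG0).trans
        (mul_le_mul_of_nonneg_left hGC (abs_nonneg _))
    linarith
  have key' : ∀ s₁ s₂, u * u * ∑ d₁, ∑ d₂, ∑ b₁, ∑ b₂, K₁ (d₁, s₁) b₁ * K₂ (d₂, s₂) b₂ *
        g d₁ d₂ s₁ s₂ b₁ b₂ ≤
      (∑ b₁, ∑ b₂, A₁ s₁ b₁ * A₂ s₂ b₂ * g (h₁ b₁) (h₂ b₂) s₁ s₂ b₁ b₂) +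
        C * (hashDist (A₁ s₁) h₁ + hashDist (A₂ s₂) h₂) := by
    intro s₁ s₂
    have hC : 0 ≤ C := by
      obtain ⟨d⟩ := ‹Nonempty D›
      by_contra! hC
      have h1 : Nonempty B₁ := by
        by_contra! h
        simpa using (hA₁ s₁).2
      have h2 : Nonempty B₂ := by
        by_contra! h
        simpa using (hA₂ s₂).2
      exact absurd ((hg0 d d s₁ s₂ h1.some h2.some).trans (hgC ..)) hC.not_ge
    have e : ∑ d₁, ∑ d₂, ∑ b₁, ∑ b₂, (if h₁ b₁ = d₁ then A₁ s₁ b₁ else 0) *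
        (if h₂ b₂ = d₂ then A₂ s₂ b₂ else 0) * g d₁ d₂ s₁ s₂ b₁ b₂ =
        ∑ b₁, ∑ b₂, A₁ s₁ b₁ * A₂ s₂ b₂ * g (h₁ b₁) (h₂ b₂) s₁ s₂ b₁ b₂ := by
      rw [Finset.sum_congr rfl fun d₁ _ => Finset.sum_comm, Finset.sum_comm]
      refine Finset.sum_congr rfl fun b₁ _ => ?_
      rw [Finset.sum_congr rfl fun d₁ _ => Finset.sum_comm, Finset.sum_comm]
      refine Finset.sum_congr rfl fun b₂ _ => ?_
      simp [ite_mul, mul_ite]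
    calc _ ≤ ∑ d₁, ∑ d₂, ((∑ b₁, ∑ b₂, (if h₁ b₁ = d₁ then A₁ s₁ b₁ else 0) *
          (if h₂ b₂ = d₂ then A₂ s₂ b₂ else 0) * g d₁ d₂ s₁ s₂ b₁ b₂) +
            C * |u * u - law (A₁ s₁) h₁ d₁ * law (A₂ s₂) h₂ d₂|) := by
          simp only [Finset.mul_sum (s := (Finset.univ : Finset D))]
          exact Finset.sum_le_sum fun d₁ _ => Finset.sum_le_sum fun d₂ _ => key d₁ d₂ s₁ s₂
      _ = (∑ b₁, ∑ b₂, A₁ s₁ b₁ * A₂ s₂ b₂ * g (h₁ b₁) (h₂ b₂) s₁ s₂ b₁ b₂) +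
            C * ∑ d₁, ∑ d₂, |u * u - law (A₁ s₁) h₁ d₁ * law (A₂ s₂) h₂ d₂| := by
          simp only [Finset.sum_add_distrib, e, ← Finset.mul_sum]
      _ ≤ _ := by
          gcongr
          exact sum_sum_abs_sub_le (law_mem_stdSimplex (hA₁ s₁) h₁)
  calc _ ≤ _ := mul_le_mul_of_nonneg_left hf (mul_nonneg hu0 hu0)
    _ = ∑ s₁, ∑ s₂, W s₁ s₂ * (u * u * ∑ d₁, ∑ d₂, ∑ b₁, ∑ b₂,
          K₁ (d₁, s₁) b₁ * K₂ (d₂, s₂) b₂ * g d₁ d₂ s₁ s₂ b₁ b₂) := by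
        simp only [Finset.mul_sum]
        refine Finset.sum_congr rfl fun s₁ _ => Finset.sum_congr rfl fun s₂ _ =>
          Finset.sum_congr rfl fun d₁ _ => Finset.sum_congr rfl fun d₂ _ =>
          Finset.sum_congr rfl fun b₁ _ => Finset.sum_congr rfl fun b₂ _ => ?_
        ring
    _ ≤ _ := Finset.sum_le_sum fun s₁ _ => Finset.sum_le_sum fun s₂ _ =>
        mul_le_mul_of_nonneg_left (key' s₁ s₂) (hW s₁ s₂)
    _ = _ := by
        simp only [mul_add, Finset.sum_add_distrib, mul_left_comm _ C, ← Finset.mul_sum]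

/-! ### Universal hashing: uniformity and binning. -/

open scoped Classical in
/-- A uniformly random member of the family `h` identifies two given distinct points with
probability at most `1 / |D|`. -/
def IsUniversal {Θ V D : Type*} [Fintype Θ] [Fintype D] (h : Θ → V → D) : Prop :=
  ∀ v v', v ≠ v' → (∑ θ, if h θ v = h θ v' then (1 : ℝ) else 0) * Fintype.card D ≤ Fintype.card Θ

theorem sum_law_sq {V D : Type*} [Fintype V] [Fintype D] (a : V → ℝ) (h : V → D)
    [DecidableEq D] :
    ∑ d, law a h d ^ 2 = ∑ v, ∑ v', a v * a v' * (if h v = h v' then (1 : ℝ) else 0) := by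
  have : ∑ d, law a h d ^ 2 = ∑ d, law a h d * law a h d := by simp [sq]
  rw [this, sum_law_mul a h (law a h)]
  refine Finset.sum_congr rfl fun v _ => ?_
  rw [law, Finset.mul_sum]
  refine Finset.sum_congr rfl fun v' _ => ?_
  by_cases e : h v = h v'
  · simp [e]
  · simp [e, Ne.symm e]

/-- Second-moment computation: distinct pairs contribute at most what the squared mean subtracts,
which leaves the diagonal `∑ a²`. The total mass is arbitrary because the bound is applied to a
truncated pmf. -/
theorem sum_sum_sq_law_sub_le {Θ V D : Type*} [Fintype Θ] [Fintype V] [Fintype D] [Nonempty D]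
    {h : Θ → V → D} (hu : IsUniversal h) {a : V → ℝ} (ha : ∀ v, 0 ≤ a v) :
    ∑ θ, ∑ d, (law a (h θ) d - (∑ v, a v) / Fintype.card D) ^ 2 ≤
      Fintype.card Θ * ∑ v, a v ^ 2 := by
  classical
  set m := ∑ v, a v with hm
  have hD : (0 : ℝ) < Fintype.card D := by exact_mod_cast Fintype.card_pos
  have e1 : ∀ θ, ∑ d, (law a (h θ) d - m / Fintype.card D) ^ 2 =
      ∑ d, law a (h θ) d ^ 2 - m ^ 2 / Fintype.card D := by
    intro θ
    simp only [sub_sq, Finset.sum_add_distrib, Finset.sum_sub_distrib, ← Finset.mul_sum,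
      ← Finset.sum_mul, sum_law, ← hm, Finset.sum_const, Finset.card_univ, nsmul_eq_mul]
    field_simp
    ring
  have e2 : ∑ θ, ∑ d, law a (h θ) d ^ 2 =
      ∑ v, ∑ v', a v * a v' * ∑ θ, (if h θ v = h θ v' then (1 : ℝ) else 0) := by
    simp only [sum_law_sq, Finset.mul_sum]
    rw [Finset.sum_comm]
    exact Finset.sum_congr rfl fun v _ => Finset.sum_comm
  have e3 : ∀ v v', a v * a v' * ∑ θ, (if h θ v = h θ v' then (1 : ℝ) else 0) ≤
      (if v = v' then a v ^ 2 * Fintype.card Θ else 0) +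
        a v * a v' * (Fintype.card Θ / Fintype.card D) := by
    intro v v'
    by_cases e : v = v'
    · subst e
      have := ha v
      simp only [if_true, Finset.sum_const, Finset.card_univ, nsmul_eq_mul, mul_one]
      have : 0 ≤ a v * a v * ((Fintype.card Θ : ℝ) / Fintype.card D) := by positivity
      nlinarith
    · rw [if_neg e, zero_add]
      exact mul_le_mul_of_nonneg_left ((le_div_iff₀ hD).2 (hu v v' e)) (mul_nonneg (ha v) (ha v'))
  simp only [e1, Finset.sum_sub_distrib, e2, Finset.sum_const, Finset.card_univ, nsmul_eq_mul]
  have := Finset.sum_le_sum fun v (_ : v ∈ Finset.univ) =>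
    Finset.sum_le_sum fun v' (_ : v' ∈ Finset.univ) => e3 v v'
  simp only [Finset.sum_add_distrib, Finset.sum_ite_eq, Finset.mem_univ, if_true,
    ← Finset.sum_mul, ← Finset.mul_sum, ← hm] at this
  calc _ ≤ _ := sub_le_sub_right this _
    _ = _ := by ring

/-- Leftover hash lemma. -/
theorem leftover_hash {Θ V D : Type*} [Fintype Θ] [Fintype V] [Fintype D] [Nonempty D]
    {h : Θ → V → D} (hu : IsUniversal h) {a : V → ℝ} (ha : a ∈ stdSimplex ℝ V) {t : ℝ}
    (ht : 0 ≤ t) :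
    ∑ θ, hashDist a (h θ) ≤
      Fintype.card Θ * (2 * (∑ v, if t < a v then a v else 0) + √(Fintype.card D * t)) := by
  classical
  -- Atoms heavier than `t` are split off. Their mass enters twice, once for the hash and once for
  -- its share of the uniform law; the light part satisfies `∑ a'² ≤ t`.
  set a' : V → ℝ := fun v => if t < a v then 0 else a v with ha'
  set a'' : V → ℝ := fun v => if t < a v then a v else 0 with ha''
  have h0' : ∀ v, 0 ≤ a' v := fun v => by simp only [ha']; split_ifs; exacts [le_rfl, ha.1 v]
  have h0'' : ∀ v, 0 ≤ a'' v := fun v => by simp only [ha'']; split_ifs; exacts [ha.1 v, le_rfl]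
  have hsum : ∀ v, a v = a' v + a'' v := fun v => by simp only [ha', ha'']; split_ifs <;> simp
  have hD : (0 : ℝ) < Fintype.card D := by exact_mod_cast Fintype.card_pos
  set m' := ∑ v, a' v with hm'
  set m'' := ∑ v, a'' v with hm''
  have hm''0 : 0 ≤ m'' := Finset.sum_nonneg fun v _ => h0'' v
  have hm : m' + m'' = 1 := by
    rw [← ha.2, hm', hm'', ← Finset.sum_add_distrib]; simp [hsum]
  have hlaw : ∀ θ d, law a (h θ) d = law a' (h θ) d + law a'' (h θ) d := by
    intro θ d
    simp only [law, ← Finset.sum_add_distrib]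
    refine Finset.sum_congr rfl fun v _ => ?_
    split_ifs
    exacts [hsum v, by simp]
  have step1 : ∀ θ, hashDist a (h θ) ≤
      ∑ d, |law a' (h θ) d - m' / Fintype.card D| + 2 * m'' := by
    intro θ
    calc hashDist a (h θ) ≤ ∑ d, (|law a' (h θ) d - m' / Fintype.card D| +
          (law a'' (h θ) d + m'' / Fintype.card D)) := by
          refine Finset.sum_le_sum fun d _ => ?_
          have : law a (h θ) d - 1 / Fintype.card D = (law a' (h θ) d - m' / Fintype.card D) +
              (law a'' (h θ) d - m'' / Fintype.card D) := by
            rw [hlaw, ← hm]; ring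
          rw [this]
          refine (abs_add_le _ _).trans (add_le_add le_rfl ?_)
          refine (abs_sub _ _).trans ?_
          rw [abs_of_nonneg (law_nonneg h0'' _ _), abs_of_nonneg (by positivity)]
      _ = _ := by
          simp only [Finset.sum_add_distrib, sum_law, Finset.sum_const, Finset.card_univ,
            nsmul_eq_mul, ← hm'']
          rw [mul_div_cancel₀ _ hD.ne']
          ring
  have step2 : ∑ θ, ∑ d, |law a' (h θ) d - m' / Fintype.card D| ≤
      Fintype.card Θ * √(Fintype.card D * t) := by
    -- Cauchy–Schwarz over seeds and hash values together.
    have hsq : (∑ i : Θ × D, |law a' (h i.1) i.2 - m' / Fintype.card D|) ^ 2 ≤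
        (Fintype.card Θ * √(Fintype.card D * t)) ^ 2 := by
      refine (sq_sum_le_card_mul_sum_sq).trans ?_
      simp only [sq_abs, Fintype.sum_prod_type, Finset.card_univ, Fintype.card_prod]
      rw [mul_pow, Real.sq_sqrt (by positivity)]
      have h2 : ∑ v, a' v ^ 2 ≤ t := by
        calc ∑ v, a' v ^ 2 ≤ ∑ v, t * a v := by
              refine Finset.sum_le_sum fun v _ => ?_
              have := ha.1 v
              simp only [ha']
              split_ifs with hv
              · simp; positivity
              · nlinarith
          _ = t := by rw [← Finset.mul_sum, ha.2, mul_one]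
      have := (sum_sum_sq_law_sub_le hu h0').trans
        (mul_le_mul_of_nonneg_left h2 (Nat.cast_nonneg _))
      calc _ ≤ ((Fintype.card Θ * Fintype.card D : ℕ) : ℝ) * (Fintype.card Θ * t) :=
            mul_le_mul_of_nonneg_left this (Nat.cast_nonneg _)
        _ = _ := by push_cast; ring
    have := abs_le_of_sq_le_sq hsq (by positivity)
    rw [Fintype.sum_prod_type] at this
    exact (le_abs_self _).trans this
  calc _ ≤ ∑ θ, (∑ d, |law a' (h θ) d - m' / Fintype.card D| + 2 * m'') :=
        Finset.sum_le_sum fun θ _ => step1 θ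
    _ ≤ Fintype.card Θ * √(Fintype.card D * t) + Fintype.card Θ * (2 * m'') := by
        rw [Finset.sum_add_distrib, Finset.sum_const, Finset.card_univ, nsmul_eq_mul]
        exact add_le_add step2 le_rfl
    _ = _ := by ring

open scoped Classical in
/-- Decoding with side information `y` from a random hash of `v`. -/
theorem exists_binning_decoder {Θ V Y D : Type*} [Fintype Θ] [Fintype V] [Fintype Y] [Fintype D]
    [Nonempty V] [Nonempty D] {h : Θ → V → D} (hu : IsUniversal h) {Q : V × Y → ℝ}
    (hQ : Q ∈ stdSimplex ℝ (V × Y)) {t : ℝ} (ht : 0 < t) :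
    ∃ ψ : Θ → D → Y → V,
      ∑ θ, (∑ i, Q i * if ψ θ (h θ i.1) i.2 ≠ i.1 then 1 else 0) ≤
        Fintype.card Θ * ((∑ i, if Q i < t * law Q Prod.snd i.2 then Q i else 0) +
          1 / (t * Fintype.card D)) := by
  have hD : (0 : ℝ) < Fintype.card D := by exact_mod_cast Fintype.card_pos
  -- Candidates for `y` are the `v` of conditional probability at least `t`. The decoder returns
  -- some candidate with the right hash.
  set T : V → Y → Prop := fun v y => t * law Q Prod.snd y ≤ Q (v, y) with hT
  refine ⟨fun θ d y => if H : ∃ v, T v y ∧ h θ v = d then H.choose else Classical.arbitrary V, ?_⟩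
  have hQ2 : ∀ y, law Q Prod.snd y = ∑ v, Q (v, y) := by
    intro y
    rw [law, Fintype.sum_prod_type]
    simp
  -- There are at most `1 / t` candidates. The factor `law Q Prod.snd y` covers outputs of
  -- probability zero, for which every `v` is a candidate.
  have hcard : ∀ y, law Q Prod.snd y * (∑ v', if T v' y then 1 else 0) ≤
      law Q Prod.snd y / t := by
    intro y
    have : t * (law Q Prod.snd y * (∑ v', if T v' y then 1 else 0)) ≤ law Q Prod.snd y := by
      refine le_trans ?_ (hQ2 y).ge
      rw [← mul_assoc, Finset.mul_sum]
      refine Finset.sum_le_sum fun v' _ => ?_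
      split_ifs with hv
      · simpa using hv
      · simpa using hQ.1 _
    rw [le_div_iff₀ ht]; linarith
  -- An error requires that the true `v` is not a candidate or that another candidate has the same
  -- hash.
  have step : ∀ θ v y, (if (if H : ∃ v', T v' y ∧ h θ v' = h θ v then H.choose
      else Classical.arbitrary V) ≠ v then (1 : ℝ) else 0) ≤
      (if Q (v, y) < t * law Q Prod.snd y then 1 else 0) +
        ∑ v', if v' ≠ v ∧ T v' y ∧ h θ v' = h θ v then 1 else 0 := by
    intro θ v y
    have n1 : (0 : ℝ) ≤ ∑ v', if v' ≠ v ∧ T v' y ∧ h θ v' = h θ v then 1 else 0 :=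
      Finset.sum_nonneg fun _ _ => by split_ifs <;> norm_num
    by_cases hv : T v y
    · have H : ∃ v', T v' y ∧ h θ v' = h θ v := ⟨v, hv, rfl⟩
      rw [dif_pos H, if_neg (show ¬ Q (v, y) < _ from not_lt.2 hv), zero_add]
      split_ifs with hne
      · have := Finset.single_le_sum (f := fun v' =>
          if v' ≠ v ∧ T v' y ∧ h θ v' = h θ v then (1 : ℝ) else 0)
          (fun _ _ => by split_ifs <;> norm_num) (Finset.mem_univ H.choose)
        simpa only [if_pos (show _ ∧ _ from ⟨hne, H.choose_spec⟩)] using this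
      · exact n1
    · have : Q (v, y) < t * law Q Prod.snd y := not_le.1 hv
      rw [if_pos this]
      have : (if (if H : ∃ v', T v' y ∧ h θ v' = h θ v then H.choose
        else Classical.arbitrary V) ≠ v then (1 : ℝ) else 0) ≤ 1 := by split_ifs <;> norm_num
      linarith
  have coll : ∀ v y, ∑ θ, ∑ v', (if v' ≠ v ∧ T v' y ∧ h θ v' = h θ v then (1 : ℝ) else 0) ≤
      Fintype.card Θ / Fintype.card D * ∑ v', if T v' y then 1 else 0 := by
    intro v y
    rw [Finset.sum_comm, Finset.mul_sum]
    refine Finset.sum_le_sum fun v' _ => ?_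
    by_cases hv : v' ≠ v ∧ T v' y
    · simp only [hv.2, if_true, hv.1, ne_eq, not_false_eq_true, true_and, mul_one]
      exact (le_div_iff₀ hD).2 (hu v' v hv.1)
    · have : ∀ θ, ¬ (v' ≠ v ∧ T v' y ∧ h θ v' = h θ v) := fun θ hh => hv ⟨hh.1, hh.2.1⟩
      simp only [this, if_false, Finset.sum_const_zero]
      positivity
  calc _ ≤ ∑ θ, ∑ i : V × Y, Q i * ((if Q i < t * law Q Prod.snd i.2 then 1 else 0) +
        ∑ v', if v' ≠ i.1 ∧ T v' i.2 ∧ h θ v' = h θ i.1 then 1 else 0) :=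
        Finset.sum_le_sum fun θ _ => Finset.sum_le_sum fun i _ =>
          mul_le_mul_of_nonneg_left (step θ i.1 i.2) (hQ.1 i)
    _ = Fintype.card Θ * (∑ i, if Q i < t * law Q Prod.snd i.2 then Q i else 0) +
        ∑ i : V × Y, Q i * ∑ θ, ∑ v', if v' ≠ i.1 ∧ T v' i.2 ∧ h θ v' = h θ i.1 then 1 else 0 := by
        simp only [mul_add, Finset.sum_add_distrib, Finset.sum_const, Finset.card_univ,
          nsmul_eq_mul, mul_ite, mul_one, mul_zero]
        congr 1
        rw [Finset.sum_comm]
        simp only [Finset.mul_sum]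
    _ ≤ Fintype.card Θ * (∑ i, if Q i < t * law Q Prod.snd i.2 then Q i else 0) +
        ∑ i : V × Y, Q i * (Fintype.card Θ / Fintype.card D * ∑ v', if T v' i.2 then 1 else 0) := by
        gcongr with i _
        · exact hQ.1 i
        · exact coll i.1 i.2
    _ = Fintype.card Θ * (∑ i, if Q i < t * law Q Prod.snd i.2 then Q i else 0) +
        Fintype.card Θ / Fintype.card D *
          ∑ y, law Q Prod.snd y * ∑ v', if T v' y then 1 else 0 := by
        congr 1
        rw [sum_law_mul Q Prod.snd fun y => ∑ v', if T v' y then (1 : ℝ) else 0, Finset.mul_sum]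
        exact Finset.sum_congr rfl fun i _ => by ring
    _ ≤ Fintype.card Θ * (∑ i, if Q i < t * law Q Prod.snd i.2 then Q i else 0) +
        Fintype.card Θ / Fintype.card D * (1 / t) := by
        gcongr
        calc _ ≤ ∑ y, law Q Prod.snd y / t := Finset.sum_le_sum fun y _ => hcard y
          _ = 1 / t := by rw [← Finset.sum_div, sum_law, hQ.2]
    _ = _ := by
        field_simp

theorem hashDist_comp {B V D : Type*} [Fintype B] [Fintype V] [Fintype D] (a : B → ℝ) (π : B → V)
    (h : V → D) : hashDist a (fun b => h (π b)) = hashDist (law a π) h := by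
  simp only [hashDist, law_law]

/-! ### The one-shot coding theorem. -/

open scoped Classical in
/-- Achievability for one use of an abstract channel. The auxiliary variables `b₁`, `b₂` carry
group elements `π₁ b₁`, `π₂ b₂` and the receiver decodes their sum. The probability space `Ω`
carries the joint law of all the variables. -/
theorem exists_code {Θ Ω S₁ S₂ B₁ B₂ Y G E₀ E₁ E₂ : Type*} [Fintype Θ] [Nonempty Θ] [Fintype Ω]
    [Fintype S₁] [Fintype S₂] [Fintype B₁] [Fintype B₂] [Fintype Y] [Fintype G] [AddCommGroup G]
    [Fintype E₀] [AddCommGroup E₀] [Fintype E₁] [AddCommGroup E₁] [Fintype E₂] [AddCommGroup E₂]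
    {h₀ : Θ → G →+ E₀} {h₁ : Θ → G →+ E₁} {h₂ : Θ → G →+ E₂}
    (hu₀ : IsUniversal fun θ v => h₀ θ v) (hu : IsUniversal fun θ v => (h₀ θ v, h₁ θ v, h₂ θ v))
    {W : S₁ → S₂ → ℝ} (hW : ∀ s₁ s₂, 0 ≤ W s₁ s₂)
    {A₁ : S₁ → B₁ → ℝ} (hA₁ : ∀ s, A₁ s ∈ stdSimplex ℝ B₁)
    {A₂ : S₂ → B₂ → ℝ} (hA₂ : ∀ s, A₂ s ∈ stdSimplex ℝ B₂)
    {N : B₁ → B₂ → S₁ → S₂ → Y → ℝ} (hN : ∀ b₁ b₂ s₁ s₂, N b₁ b₂ s₁ s₂ ∈ stdSimplex ℝ Y)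
    {P : Ω → ℝ} (hP : P ∈ stdSimplex ℝ Ω) (s₁ : Ω → S₁) (s₂ : Ω → S₂) (b₁ : Ω → B₁) (b₂ : Ω → B₂)
    (y : Ω → Y)
    (hPW : ∀ φ : S₁ → S₂ → B₁ → B₂ → Y → ℝ,
      ∑ ω, P ω * φ (s₁ ω) (s₂ ω) (b₁ ω) (b₂ ω) (y ω) =
        ∑ s₁, ∑ s₂, W s₁ s₂ * ∑ b₁, ∑ b₂, A₁ s₁ b₁ * A₂ s₂ b₂ *
          ∑ y, N b₁ b₂ s₁ s₂ y * φ s₁ s₂ b₁ b₂ y)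
    (π₁ : B₁ → G) (π₂ : B₂ → G) (c₁ : S₁ → B₁ → Prop) (c₂ : S₂ → B₂ → Prop)
    {t₀ t₁ t₂ : ℝ} (ht₀ : 0 < t₀) (ht₁ : 0 ≤ t₁) (ht₂ : 0 ≤ t₂) :
    ∃ (f₁ : E₁ → S₁ → B₁) (f₂ : E₂ → S₂ → B₂) (dec : Y → E₁ × E₂),
      ∑ m₁, ∑ m₂, ∑ s₁, ∑ s₂, W s₁ s₂ *
        ((∑ y, if dec y = (m₁, m₂) then 0 else N (f₁ m₁ s₁) (f₂ m₂ s₂) s₁ s₂ y) +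
          (if c₁ s₁ (f₁ m₁ s₁) then 1 else 0) + (if c₂ s₂ (f₂ m₂ s₂) then 1 else 0)) ≤
      Fintype.card E₁ * Fintype.card E₂ *
        ((∑ ω, P ω * if c₁ (s₁ ω) (b₁ ω) then 1 else 0) +
          (∑ ω, P ω * if c₂ (s₂ ω) (b₂ ω) then 1 else 0) +
          (∑ ω, P ω * if law P (fun ω => (π₁ (b₁ ω) + π₂ (b₂ ω), y ω))
            (π₁ (b₁ ω) + π₂ (b₂ ω), y ω) < t₀ * law P y (y ω) then 1 else 0) +
          1 / (t₀ * Fintype.card E₀) +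
          3 * (2 * (∑ ω, P ω * if t₁ < law (A₁ (s₁ ω)) π₁ (π₁ (b₁ ω)) then 1 else 0) +
            √(Fintype.card (E₀ × E₁ × E₂) * t₁) +
            2 * (∑ ω, P ω * if t₂ < law (A₂ (s₂ ω)) π₂ (π₂ (b₂ ω)) then 1 else 0) +
            √(Fintype.card (E₀ × E₁ × E₂) * t₂))) := by
  set Q := law P (fun ω => (π₁ (b₁ ω) + π₂ (b₂ ω), y ω)) with hQ
  have hQm : Q ∈ stdSimplex ℝ (G × Y) := law_mem_stdSimplex hP _
  obtain ⟨ψ, hψ⟩ := exists_binning_decoder hu₀ hQm ht₀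
  set hash : Θ → G → E₀ × E₁ × E₂ := fun θ v => (h₀ θ v, h₁ θ v, h₂ θ v) with hhash
  -- Only the frozen parts of `d₁` and `d₂` are read: the `E₀`-parts form the bin index of the sum,
  -- and the remaining two are subtracted to isolate the messages.
  set dec : Θ → E₀ × E₁ × E₂ → E₀ × E₁ × E₂ → Y → E₁ × E₂ := fun θ d₁ d₂ y =>
    (h₁ θ (ψ θ (d₁.1 + d₂.1) y) - d₂.2.1, h₂ θ (ψ θ (d₁.1 + d₂.1) y) - d₁.2.2) with hdec
  -- Decoding failure and the two cost violations are added into one cost, so that a single choice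
  -- of code controls all three; each is at most 1, whence the constant 3.
  set g : Θ → E₀ × E₁ × E₂ → E₀ × E₁ × E₂ → S₁ → S₂ → B₁ → B₂ → ℝ :=
    fun θ d₁ d₂ s₁ s₂ b₁ b₂ =>
      (∑ y, if dec θ d₁ d₂ y = (d₁.2.1, d₂.2.2) then 0 else N b₁ b₂ s₁ s₂ y) +
      (if c₁ s₁ b₁ then 1 else 0) + (if c₂ s₂ b₂ then 1 else 0) with hg
  have hg0 : ∀ θ d₁ d₂ s₁ s₂ b₁ b₂, 0 ≤ g θ d₁ d₂ s₁ s₂ b₁ b₂ := by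
    intro θ d₁ d₂ s₁ s₂ b₁ b₂
    refine add_nonneg (add_nonneg (Finset.sum_nonneg fun y _ => ?_) ?_) ?_
    · split_ifs
      exacts [le_rfl, (hN ..).1 y]
    all_goals split_ifs <;> norm_num
  have hg3 : ∀ θ d₁ d₂ s₁ s₂ b₁ b₂, g θ d₁ d₂ s₁ s₂ b₁ b₂ ≤ 3 := by
    intro θ d₁ d₂ s₁ s₂ b₁ b₂
    have k1 : (∑ y, if dec θ d₁ d₂ y = (d₁.2.1, d₂.2.2) then 0 else N b₁ b₂ s₁ s₂ y) ≤ 1 := by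
      rw [← (hN b₁ b₂ s₁ s₂).2]
      refine Finset.sum_le_sum fun y _ => ?_
      split_ifs
      exacts [(hN ..).1 y, le_rfl]
    have k2 : ∀ p : Prop, (if p then (1 : ℝ) else 0) ≤ 1 := fun p => by split_ifs <;> norm_num
    have := k2 (c₁ s₁ b₁)
    have := k2 (c₂ s₂ b₂)
    simp only [hg]
    linarith
  choose f₁ f₂ hf using fun θ => exists_encoders hW hA₁ hA₂ (fun b => hash θ (π₁ b))
    (fun b => hash θ (π₂ b)) (hg0 θ) (hg3 θ)
  have hNsum : ∀ b₁ b₂ s₁ s₂ (x : ℝ), ∑ y, N b₁ b₂ s₁ s₂ y * x = x := by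
    intro b₁ b₂ s₁ s₂ x
    rw [← Finset.sum_mul, (hN ..).2, one_mul]
  have eW : ∑ s₁, ∑ s₂, W s₁ s₂ = 1 := by
    have := hPW fun _ _ _ _ _ => 1
    simpa [hP.2, (hN _ _ _ _).2, ← Finset.mul_sum, ← Finset.sum_mul, (hA₁ _).2, (hA₂ _).2]
      using this.symm
  have eaff : ∀ (K c : ℝ) (x : S₁ → S₂ → ℝ), ∑ s₁, ∑ s₂, W s₁ s₂ * (K * (2 * x s₁ s₂ + c)) =
      K * (2 * (∑ s₁, ∑ s₂, W s₁ s₂ * x s₁ s₂) + c) := by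
    intro K c x
    have : ∀ s₁ s₂, W s₁ s₂ * (K * (2 * x s₁ s₂ + c)) =
        K * 2 * (W s₁ s₂ * x s₁ s₂) + W s₁ s₂ * (K * c) := fun _ _ => by ring
    simp only [this, Finset.sum_add_distrib, ← Finset.mul_sum, ← Finset.sum_mul, eW]
    ring
  have eL₁ : ∑ s₁, ∑ s₂, W s₁ s₂ * (∑ v, if t₁ < law (A₁ s₁) π₁ v then law (A₁ s₁) π₁ v else 0) =
      ∑ ω, P ω * if t₁ < law (A₁ (s₁ ω)) π₁ (π₁ (b₁ ω)) then 1 else 0 := by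
    rw [hPW fun s₁ s₂ b₁ b₂ y => if t₁ < law (A₁ s₁) π₁ (π₁ b₁) then 1 else 0]
    refine Finset.sum_congr rfl fun s₁ _ => Finset.sum_congr rfl fun s₂ _ => ?_
    congr 1
    have := sum_law_mul (A₁ s₁) π₁ fun v => if t₁ < law (A₁ s₁) π₁ v then 1 else 0
    simp only [mul_ite, mul_one, mul_zero] at this
    simp only [hNsum, mul_assoc, ← Finset.mul_sum, ← Finset.sum_mul, (hA₂ _).2, one_mul]
    simpa using this
  have eL₂ : ∑ s₁, ∑ s₂, W s₁ s₂ * (∑ v, if t₂ < law (A₂ s₂) π₂ v then law (A₂ s₂) π₂ v else 0) =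
      ∑ ω, P ω * if t₂ < law (A₂ (s₂ ω)) π₂ (π₂ (b₂ ω)) then 1 else 0 := by
    rw [hPW fun s₁ s₂ b₁ b₂ y => if t₂ < law (A₂ s₂) π₂ (π₂ b₂) then 1 else 0]
    refine Finset.sum_congr rfl fun s₁ _ => Finset.sum_congr rfl fun s₂ _ => ?_
    congr 1
    have := sum_law_mul (A₂ s₂) π₂ fun v => if t₂ < law (A₂ s₂) π₂ v then 1 else 0
    simp only [mul_ite, mul_one, mul_zero] at this
    simp only [hNsum, mul_assoc, ← Finset.mul_sum, ← Finset.sum_mul, (hA₁ _).2, one_mul]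
    simpa using this
  have hD₁ : ∑ θ, ∑ s₁, ∑ s₂, W s₁ s₂ * hashDist (A₁ s₁) (fun b => hash θ (π₁ b)) ≤
      Fintype.card Θ * (2 * (∑ ω, P ω * if t₁ < law (A₁ (s₁ ω)) π₁ (π₁ (b₁ ω)) then 1 else 0) +
            √(Fintype.card (E₀ × E₁ × E₂) * t₁)) := by
    rw [← eL₁, Finset.sum_comm]
    calc _ = ∑ s₁, ∑ s₂, W s₁ s₂ * ∑ θ, hashDist (law (A₁ s₁) π₁) (hash θ) := by
          refine Finset.sum_congr rfl fun s₁ _ => ?_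
          rw [Finset.sum_comm]
          simp only [hashDist_comp, Finset.mul_sum]
      _ ≤ ∑ s₁, ∑ s₂, W s₁ s₂ * (Fintype.card Θ * (2 *
            (∑ v, if t₁ < law (A₁ s₁) π₁ v then law (A₁ s₁) π₁ v else 0) +
            √(Fintype.card (E₀ × E₁ × E₂) * t₁))) :=
          Finset.sum_le_sum fun s₁ _ => Finset.sum_le_sum fun s₂ _ =>
            mul_le_mul_of_nonneg_left
              (leftover_hash hu (law_mem_stdSimplex (hA₁ s₁) π₁) ht₁) (hW s₁ s₂)
      _ = _ := by
          exact eaff _ _ _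
  have hD₂ : ∑ θ, ∑ s₁, ∑ s₂, W s₁ s₂ * hashDist (A₂ s₂) (fun b => hash θ (π₂ b)) ≤
      Fintype.card Θ * (2 * (∑ ω, P ω * if t₂ < law (A₂ (s₂ ω)) π₂ (π₂ (b₂ ω)) then 1 else 0) +
            √(Fintype.card (E₀ × E₁ × E₂) * t₂)) := by
    rw [← eL₂, Finset.sum_comm]
    calc _ = ∑ s₁, ∑ s₂, W s₁ s₂ * ∑ θ, hashDist (law (A₂ s₂) π₂) (hash θ) := by
          refine Finset.sum_congr rfl fun s₁ _ => ?_
          rw [Finset.sum_comm]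
          simp only [hashDist_comp, Finset.mul_sum]
      _ ≤ ∑ s₁, ∑ s₂, W s₁ s₂ * (Fintype.card Θ * (2 *
            (∑ v, if t₂ < law (A₂ s₂) π₂ v then law (A₂ s₂) π₂ v else 0) +
            √(Fintype.card (E₀ × E₁ × E₂) * t₂))) :=
          Finset.sum_le_sum fun s₁ _ => Finset.sum_le_sum fun s₂ _ =>
            mul_le_mul_of_nonneg_left
              (leftover_hash hu (law_mem_stdSimplex (hA₂ s₂) π₂) ht₂) (hW s₁ s₂)
      _ = _ := by
          exact eaff _ _ _
  -- When the indices are true hashes, `h₀` of the sum is the sum of the `h₀`-parts, so a correctly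
  -- binned sum yields both messages.
  have hiid : ∀ θ, ∑ s₁, ∑ s₂, W s₁ s₂ * ∑ b₁, ∑ b₂, A₁ s₁ b₁ * A₂ s₂ b₂ *
        g θ (hash θ (π₁ b₁)) (hash θ (π₂ b₂)) s₁ s₂ b₁ b₂ ≤
      (∑ ω, P ω * if c₁ (s₁ ω) (b₁ ω) then 1 else 0) +
          (∑ ω, P ω * if c₂ (s₂ ω) (b₂ ω) then 1 else 0) +
      ∑ i, Q i * if ψ θ (h₀ θ i.1) i.2 ≠ i.1 then 1 else 0 := by
    intro θ
    have e := sum_law_mul P (fun ω => (π₁ (b₁ ω) + π₂ (b₂ ω), y ω)) fun i =>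
      if ψ θ (h₀ θ i.1) i.2 ≠ i.1 then 1 else 0
    rw [← hQ] at e
    rw [e, ← Finset.sum_add_distrib, ← Finset.sum_add_distrib]
    simp only [← mul_add]
    rw [hPW fun s₁ s₂ b₁ b₂ y => (if c₁ s₁ b₁ then 1 else 0) + (if c₂ s₂ b₂ then 1 else 0) +
      if ψ θ (h₀ θ (π₁ b₁ + π₂ b₂)) y ≠ π₁ b₁ + π₂ b₂ then 1 else 0]
    refine Finset.sum_le_sum fun s₁ _ => Finset.sum_le_sum fun s₂ _ =>
      mul_le_mul_of_nonneg_left (Finset.sum_le_sum fun b₁ _ => Finset.sum_le_sum fun b₂ _ =>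
        mul_le_mul_of_nonneg_left ?_ (mul_nonneg ((hA₁ _).1 _) ((hA₂ _).1 _))) (hW s₁ s₂)
    simp only [mul_add, Finset.sum_add_distrib, hNsum, hg]
    rw [add_comm _ (∑ y, _), ← add_assoc]
    gcongr with y _
    by_cases hd : ψ θ (h₀ θ (π₁ b₁ + π₂ b₂)) y = π₁ b₁ + π₂ b₂
    · have : dec θ (hash θ (π₁ b₁)) (hash θ (π₂ b₂)) y =
          ((hash θ (π₁ b₁)).2.1, (hash θ (π₂ b₂)).2.2) := by
        simp only [hdec, hhash]
        rw [← map_add, hd]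
        simp
      rw [if_pos this]
      exact mul_nonneg ((hN ..).1 y) (by split_ifs <;> norm_num)
    · simp only [hd, ne_eq, not_false_eq_true, if_true, mul_one]
      split_ifs
      exacts [(hN ..).1 y, le_rfl]
  have hψ' : ∑ θ, (∑ i, Q i * if ψ θ (h₀ θ i.1) i.2 ≠ i.1 then 1 else 0) ≤
      Fintype.card Θ * ((∑ ω, P ω * if Q (π₁ (b₁ ω) + π₂ (b₂ ω), y ω) < t₀ * law P y (y ω)
        then 1 else 0) + 1 / (t₀ * Fintype.card E₀)) := by
    refine hψ.trans_eq ?_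
    congr 2
    have := sum_law_mul P (fun ω => (π₁ (b₁ ω) + π₂ (b₂ ω), y ω)) fun i =>
      if Q i < t₀ * law Q Prod.snd i.2 then 1 else 0
    rw [← hQ] at this
    rw [hQ, law_law, ← hQ] at this
    rw [← this]
    rw [hQ, law_law, ← hQ]
    simp only [mul_ite, mul_one, mul_zero]
  set ε := (∑ ω, P ω * if c₁ (s₁ ω) (b₁ ω) then 1 else 0) + _ + _ + _ + _ with hε
  -- Averaging over the seed fixes one hash family.
  obtain ⟨θ, -, hθ⟩ := Finset.exists_le_of_sum_le (s := (Finset.univ : Finset Θ))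
    Finset.univ_nonempty (g := fun _ => ε) (f := fun θ =>
      (1 / (Fintype.card (E₀ × E₁ × E₂) : ℝ) * (1 / Fintype.card (E₀ × E₁ × E₂))) *
        (∑ s₁, ∑ s₂, ∑ d₁, ∑ d₂, W s₁ s₂ * g θ d₁ d₂ s₁ s₂ (f₁ θ d₁ s₁) (f₂ θ d₂ s₂))) (by
      refine (Finset.sum_le_sum fun θ _ => hf θ).trans ?_
      have := Finset.sum_le_sum fun θ (_ : θ ∈ Finset.univ) => hiid θ
      simp only [Finset.sum_add_distrib, ← Finset.mul_sum, Finset.sum_const, Finset.card_univ,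
        nsmul_eq_mul] at this ⊢
      rw [hε]
      linarith)
  -- Averaging again fixes the non-message parts: a pair of indices is the same as the frozen parts
  -- `r` together with a message pair.
  obtain ⟨r, -, hr⟩ := Finset.exists_le_of_sum_le
    (s := (Finset.univ : Finset ((E₀ × E₂) × (E₀ × E₁)))) Finset.univ_nonempty
    (g := fun _ => Fintype.card E₁ * Fintype.card E₂ * ε) (f := fun r =>
      ∑ m₁, ∑ m₂, ∑ s₁, ∑ s₂, W s₁ s₂ * g θ (r.1.1, m₁, r.1.2) (r.2.1, r.2.2, m₂) s₁ s₂
        (f₁ θ (r.1.1, m₁, r.1.2) s₁) (f₂ θ (r.2.1, r.2.2, m₂) s₂)) (by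
      have e : ∑ r : (E₀ × E₂) × (E₀ × E₁), ∑ m₁, ∑ m₂, ∑ s₁, ∑ s₂, W s₁ s₂ *
          g θ (r.1.1, m₁, r.1.2) (r.2.1, r.2.2, m₂) s₁ s₂
            (f₁ θ (r.1.1, m₁, r.1.2) s₁) (f₂ θ (r.2.1, r.2.2, m₂) s₂) =
          ∑ s₁, ∑ s₂, ∑ d₁, ∑ d₂, W s₁ s₂ * g θ d₁ d₂ s₁ s₂ (f₁ θ d₁ s₁) (f₂ θ d₂ s₂) := by
        rw [← sum_comm₄ fun d₁ s₁ d₂ s₂ => W s₁ s₂ * g θ d₁ d₂ s₁ s₂ (f₁ θ d₁ s₁) (f₂ θ d₂ s₂)]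
        simp only [← Fintype.sum_prod_type']
        exact Fintype.sum_equiv
          { toFun := fun x => ((x.1.1.1, x.2.1, x.1.1.2), x.2.2.2.1,
              (x.1.2.1, x.1.2.2, x.2.2.1), x.2.2.2.2)
            invFun := fun z => (((z.1.1, z.1.2.2), (z.2.2.1.1, z.2.2.1.2.1)), z.1.2.1,
              z.2.2.1.2.2, z.2.1, z.2.2.2)
            left_inv := fun _ => rfl
            right_inv := fun _ => rfl } _ _ fun _ => rfl
      rw [e, Finset.sum_const, Finset.card_univ, nsmul_eq_mul]
      have hpos : (0 : ℝ) < Fintype.card (E₀ × E₁ × E₂) := by exact_mod_cast Fintype.card_pos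
      rw [one_div, ← mul_inv, inv_mul_le_iff₀ (by positivity)] at hθ
      refine hθ.trans_eq ?_
      simp only [Fintype.card_prod]
      push_cast
      ring)
  -- The arbitrary elements fill the message slots, which `dec` does not read.
  exact ⟨fun m s => f₁ θ (r.1.1, m, r.1.2) s, fun m s => f₂ θ (r.2.1, r.2.2, m) s,
    dec θ (r.1.1, Classical.arbitrary E₁, r.1.2) (r.2.1, r.2.2, Classical.arbitrary E₂), hr⟩

/-! ### Product probability mass functions -/

theorem sum_pi_prod {n : ℕ} {B : Type*} [Fintype B] (f : Fin n → B → ℝ) :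
    ∑ b : Fin n → B, ∏ i, f i (b i) = ∏ i, ∑ b, f i b := by
  classical
  rw [Finset.prod_univ_sum, Fintype.piFinset_univ]

theorem pi_mem_stdSimplex {n : ℕ} {B : Type*} [Fintype B] {a : Fin n → B → ℝ}
    (ha : ∀ i, a i ∈ stdSimplex ℝ B) :
    (fun b : Fin n → B => ∏ i, a i (b i)) ∈ stdSimplex ℝ (Fin n → B) :=
  ⟨fun b => Finset.prod_nonneg fun i _ => (ha i).1 _, by
    rw [sum_pi_prod]; exact Finset.prod_eq_one fun i _ => (ha i).2⟩

theorem law_pi {n : ℕ} {B V : Type*} [Fintype B] (a : Fin n → B → ℝ) (π : B → V)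
    (v : Fin n → V) :
    law (fun b : Fin n → B => ∏ i, a i (b i)) (fun b i => π (b i)) v =
      ∏ i, law (a i) π (v i) := by
  classical
  simp only [law]
  rw [← sum_pi_prod]
  refine Finset.sum_congr rfl fun b _ => ?_
  by_cases h : (fun i => π (b i)) = v
  · subst h; simp
  · rw [if_neg h]
    obtain ⟨i, hi⟩ := Function.ne_iff.1 h
    exact (Finset.prod_eq_zero (Finset.mem_univ i) (if_neg hi)).symm

theorem sum_pi_succ {n : ℕ} {Ω : Type*} [Fintype Ω] (φ : (Fin (n + 1) → Ω) → ℝ) :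
    ∑ ω, φ ω = ∑ a, ∑ ω : Fin n → Ω, φ (Fin.cons a ω) := by
  rw [← Fintype.sum_prod_type']
  exact (Fintype.sum_equiv (Fin.consEquiv fun _ => Ω) _ _ fun _ => rfl).symm

theorem sum_pi_mul_sum {Ω : Type*} [Fintype Ω] {p : Ω → ℝ} (hp : p ∈ stdSimplex ℝ Ω)
    (Z : Ω → ℝ) (n : ℕ) :
    ∑ ω : Fin n → Ω, (∏ i, p (ω i)) * ∑ i, Z (ω i) = n * ∑ ω, p ω * Z ω := by
  induction n with
  | zero => simp
  | succ n ih =>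
    have h1 : ∑ ω : Fin n → Ω, ∏ i, p (ω i) = 1 := (pi_mem_stdSimplex fun _ => hp).2
    rw [sum_pi_succ]
    simp only [Fin.prod_univ_succ, Fin.sum_univ_succ, Fin.cons_zero, Fin.cons_succ]
    calc _ = ∑ a, (p a * Z a * (∑ ω : Fin n → Ω, ∏ i, p (ω i)) +
          p a * ∑ ω : Fin n → Ω, (∏ i, p (ω i)) * ∑ i, Z (ω i)) := by
          refine Finset.sum_congr rfl fun a _ => ?_
          rw [Finset.mul_sum, Finset.mul_sum, ← Finset.sum_add_distrib]
          exact Finset.sum_congr rfl fun ω _ => by ring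
      _ = _ := by
          rw [ih, h1, Finset.sum_add_distrib, ← Finset.sum_mul, ← Finset.sum_mul, hp.2]
          push_cast
          ring

/-- Variances of independent centred variables add: on splitting off one coordinate the cross term
vanishes. -/
theorem sum_pi_mul_sq_sum {Ω : Type*} [Fintype Ω] {p : Ω → ℝ} (hp : p ∈ stdSimplex ℝ Ω)
    {Z : Ω → ℝ} (hZ : ∑ ω, p ω * Z ω = 0) (n : ℕ) :
    ∑ ω : Fin n → Ω, (∏ i, p (ω i)) * (∑ i, Z (ω i)) ^ 2 = n * ∑ ω, p ω * Z ω ^ 2 := by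
  induction n with
  | zero => simp
  | succ n ih =>
    have h1 : ∑ ω : Fin n → Ω, ∏ i, p (ω i) = 1 := (pi_mem_stdSimplex fun _ => hp).2
    have h2 := sum_pi_mul_sum hp Z n
    rw [hZ, mul_zero] at h2
    rw [sum_pi_succ]
    simp only [Fin.prod_univ_succ, Fin.sum_univ_succ, Fin.cons_zero, Fin.cons_succ]
    calc _ = ∑ a, (p a * Z a ^ 2 * (∑ ω : Fin n → Ω, ∏ i, p (ω i)) +
          2 * (p a * Z a) * (∑ ω : Fin n → Ω, (∏ i, p (ω i)) * ∑ i, Z (ω i)) +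
          p a * ∑ ω : Fin n → Ω, (∏ i, p (ω i)) * (∑ i, Z (ω i)) ^ 2) := by
          refine Finset.sum_congr rfl fun a _ => ?_
          rw [Finset.mul_sum, Finset.mul_sum, Finset.mul_sum, ← Finset.sum_add_distrib,
            ← Finset.sum_add_distrib]
          exact Finset.sum_congr rfl fun ω _ => by ring
      _ = _ := by
          rw [ih, h1, h2]
          simp only [mul_one, mul_zero, add_zero]
          rw [Finset.sum_add_distrib, ← Finset.sum_mul, hp.2]
          push_cast
          ring

open scoped Classical in
/-- Chebyshev's inequality for the upper tail of a sum of i.i.d. variables. -/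
theorem upper_tail_le {Ω : Type*} [Fintype Ω] {p : Ω → ℝ} (hp : p ∈ stdSimplex ℝ Ω)
    (Z : Ω → ℝ) {n : ℕ} (hn : 0 < n) {ε : ℝ} (hε : 0 < ε) :
    ∑ ω : Fin n → Ω, (∏ i, p (ω i)) *
        (if n * (expect p Z + ε) < ∑ i, Z (ω i) then 1 else 0) ≤
      expect p (fun ω => (Z ω - expect p Z) ^ 2) / ε ^ 2 / n := by
  have hn' : (0 : ℝ) < n := by exact_mod_cast hn
  set μ := expect p Z with hμ
  have hZ : ∑ ω, p ω * (Z ω - μ) = 0 := by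
    simp only [mul_sub, Finset.sum_sub_distrib, ← Finset.sum_mul, hp.2, hμ, expect, one_mul,
      sub_self]
  have h := sum_pi_mul_sq_sum hp hZ n
  have key : ∀ ω : Fin n → Ω, (∏ i, p (ω i)) *
      (if n * (μ + ε) < ∑ i, Z (ω i) then 1 else 0) ≤
      (∏ i, p (ω i)) * (∑ i, (Z (ω i) - μ)) ^ 2 / (n * ε) ^ 2 := by
    intro ω
    have hω : 0 ≤ ∏ i, p (ω i) := Finset.prod_nonneg fun i _ => hp.1 _
    rw [mul_div_assoc]
    refine mul_le_mul_of_nonneg_left ?_ hω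
    split_ifs with hlt
    · rw [one_le_div (by positivity)]
      have e : ∑ i, (Z (ω i) - μ) = (∑ i, Z (ω i)) - n * μ := by simp [Finset.sum_sub_distrib]
      rw [e]
      exact pow_le_pow_left₀ (by positivity) (by linarith) 2
    · positivity
  refine (Finset.sum_le_sum fun ω _ => key ω).trans_eq ?_
  rw [← Finset.sum_div, h, expect]
  field_simp

open scoped Classical in
theorem lower_tail_le {Ω : Type*} [Fintype Ω] {p : Ω → ℝ} (hp : p ∈ stdSimplex ℝ Ω)
    (Z : Ω → ℝ) {n : ℕ} (hn : 0 < n) {ε : ℝ} (hε : 0 < ε) :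
    ∑ ω : Fin n → Ω, (∏ i, p (ω i)) *
        (if ∑ i, Z (ω i) < n * (expect p Z - ε) then 1 else 0) ≤
      expect p (fun ω => (Z ω - expect p Z) ^ 2) / ε ^ 2 / n := by
  have := upper_tail_le hp (fun ω => - Z ω) hn hε
  have e : expect p (fun ω => - Z ω) = - expect p Z := by simp [expect]
  have e2 : ∀ ω : Fin n → Ω, (n * (- expect p Z + ε) < ∑ i, - Z (ω i)) ↔
      (∑ i, Z (ω i) < n * (expect p Z - ε)) := by
    intro ω
    rw [Finset.sum_neg_distrib]
    constructor <;> intro h <;> linarith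
  have e3 : ∀ ω, (- Z ω - - expect p Z) ^ 2 = (Z ω - expect p Z) ^ 2 := fun ω => by ring
  simpa only [e, e2, e3] using this

/-! ### Conditional entropy -/

/-- The conditional information density `-log₂ p_{A|B}`. -/
def condInfo {Ω α β : Type*} [Fintype Ω] (p : Ω → ℝ) (A : Ω → α) (B : Ω → β) (ω : Ω) : ℝ :=
  -Real.logb 2 (condLaw p A B (A ω) (B ω))

theorem expect_condInfo {Ω α β : Type*} [Fintype Ω] [Fintype α] [Fintype β] (p : Ω → ℝ)
    (A : Ω → α) (B : Ω → β) : expect p (condInfo p A B) = condEntropy p A B := by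
  have := sum_law_mul p (fun ω => (A ω, B ω)) fun i => Real.logb 2 (condLaw p A B i.1 i.2)
  rw [Fintype.sum_prod_type] at this
  rw [condEntropy, this, expect]
  simp [condInfo]

theorem law_pos {Ω α : Type*} [Fintype Ω] {p : Ω → ℝ} (hp : ∀ ω, 0 ≤ p ω) (A : Ω → α) {ω : Ω}
    (hω : 0 < p ω) : 0 < law p A (A ω) := by
  classical
  rw [law]
  refine Finset.sum_pos' (fun ω _ => by split_ifs <;> simp [hp]) ⟨ω, Finset.mem_univ ω, ?_⟩
  simpa using hω

theorem condLaw_pos {Ω α β : Type*} [Fintype Ω] {p : Ω → ℝ} (hp : ∀ ω, 0 ≤ p ω) (A : Ω → α)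
    (B : Ω → β) {ω : Ω} (hω : 0 < p ω) : 0 < condLaw p A B (A ω) (B ω) :=
  div_pos (law_pos hp (fun ω => (A ω, B ω)) hω) (law_pos hp B hω)

theorem law_pair_le {Ω α β : Type*} [Fintype Ω] {p : Ω → ℝ} (hp : ∀ ω, 0 ≤ p ω) (A : Ω → α)
    (B : Ω → β) (a : α) (b : β) : law p (fun ω => (A ω, B ω)) (a, b) ≤ law p B b := by
  classical
  refine Finset.sum_le_sum fun ω _ => ?_
  by_cases h : A ω = a ∧ B ω = b
  · simp [h]
  · rw [if_neg (by simpa using h)]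
    split_ifs <;> simp [hp]

theorem condLaw_le_one {Ω α β : Type*} [Fintype Ω] {p : Ω → ℝ} (hp : ∀ ω, 0 ≤ p ω) (A : Ω → α)
    (B : Ω → β) (a : α) (b : β) : condLaw p A B a b ≤ 1 :=
  div_le_one_of_le₀ (law_pair_le hp A B a b) (law_nonneg hp B b)

theorem condEntropy_nonneg {Ω α β : Type*} [Fintype Ω] [Fintype α] [Fintype β] {p : Ω → ℝ}
    (hp : ∀ ω, 0 ≤ p ω) (A : Ω → α) (B : Ω → β) : 0 ≤ condEntropy p A B := by
  rw [← expect_condInfo]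
  refine Finset.sum_nonneg fun ω _ => mul_nonneg (hp ω) ?_
  rw [condInfo, neg_nonneg]
  exact Real.logb_nonpos (by norm_num)
    (div_nonneg (law_nonneg hp _ _) (law_nonneg hp _ _)) (condLaw_le_one hp ..)

/-- Turns thresholds on conditional probabilities of words into tail events for a sum of i.i.d.
information densities. -/
theorem prod_condLaw_eq_rpow {Ω α β : Type*} [Fintype Ω] {p : Ω → ℝ} (hp : ∀ ω, 0 ≤ p ω)
    (A : Ω → α) (B : Ω → β) {n : ℕ} {ω : Fin n → Ω} (hω : ∀ i, 0 < p (ω i)) :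
    ∏ i, condLaw p A B (A (ω i)) (B (ω i)) = (2 : ℝ) ^ (-∑ i, condInfo p A B (ω i)) := by
  rw [← Finset.sum_neg_distrib, Real.rpow_sum_of_pos (by norm_num)]
  refine Finset.prod_congr rfl fun i _ => ?_
  rw [condInfo, neg_neg, Real.rpow_logb (by norm_num) (by norm_num) (condLaw_pos hp A B (hω i))]

open scoped Classical in
/-- Sequences whose conditional probability is small are improbable. -/
theorem law_pi_lt_le {Ω α β : Type*} [Fintype Ω] [Fintype α] [Fintype β] {p : Ω → ℝ}
    (hp : p ∈ stdSimplex ℝ Ω) (A : Ω → α) (B : Ω → β) {n : ℕ} (hn : 0 < n) {ε : ℝ} (hε : 0 < ε) :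
    ∑ ω : Fin n → Ω, (∏ i, p (ω i)) *
        (if ∏ i, law p (fun ω => (A ω, B ω)) (A (ω i), B (ω i)) <
          2 ^ (-(n * (condEntropy p A B + ε))) * ∏ i, law p B (B (ω i)) then 1 else 0) ≤
      expect p (fun ω => (condInfo p A B ω - condEntropy p A B) ^ 2) / ε ^ 2 / n := by
  have := upper_tail_le hp (condInfo p A B) hn hε
  simp only [expect_condInfo] at this
  refine le_trans (Finset.sum_le_sum fun ω _ => ?_) this
  have hω0 : 0 ≤ ∏ i, p (ω i) := Finset.prod_nonneg fun i _ => hp.1 _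
  -- Words of probability zero carry no weight; they are discarded because the logarithm is
  -- meaningless there.
  rcases hω0.eq_or_lt with h0 | hpos
  · simp [← h0]
  have hω : ∀ i, 0 < p (ω i) := fun i => (hp.1 _).lt_of_ne' fun h =>
    hpos.ne' (Finset.prod_eq_zero (Finset.mem_univ i) h)
  refine mul_le_mul_of_nonneg_left ?_ hω0
  by_cases hlt : ∏ i, law p (fun ω => (A ω, B ω)) (A (ω i), B (ω i)) <
          2 ^ (-(n * (condEntropy p A B + ε))) * ∏ i, law p B (B (ω i))
  · rw [if_pos hlt, if_pos]
    rw [← div_lt_iff₀ (Finset.prod_pos fun i _ => law_pos hp.1 B (hω i)),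
      ← Finset.prod_div_distrib] at hlt
    change ∏ i, condLaw p A B (A (ω i)) (B (ω i)) < _ at hlt
    rw [prod_condLaw_eq_rpow hp.1 A B hω, Real.rpow_lt_rpow_left_iff (by norm_num)] at hlt
    linarith
  · rw [if_neg hlt]
    split_ifs <;> norm_num

open scoped Classical in
/-- Sequences whose conditional probability is large are improbable. -/
theorem lt_prod_condLaw_le {Ω α β : Type*} [Fintype Ω] [Fintype α] [Fintype β] {p : Ω → ℝ}
    (hp : p ∈ stdSimplex ℝ Ω) (A : Ω → α) (B : Ω → β) {n : ℕ} (hn : 0 < n) {ε : ℝ} (hε : 0 < ε) :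
    ∑ ω : Fin n → Ω, (∏ i, p (ω i)) *
        (if 2 ^ (-(n * (condEntropy p A B - ε))) <
          ∏ i, condLaw p A B (A (ω i)) (B (ω i)) then 1 else 0) ≤
      expect p (fun ω => (condInfo p A B ω - condEntropy p A B) ^ 2) / ε ^ 2 / n := by
  have := lower_tail_le hp (condInfo p A B) hn hε
  simp only [expect_condInfo] at this
  refine le_trans (Finset.sum_le_sum fun ω _ => ?_) this
  have hω0 : 0 ≤ ∏ i, p (ω i) := Finset.prod_nonneg fun i _ => hp.1 _
  rcases hω0.eq_or_lt with h0 | hpos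
  · simp [← h0]
  have hω : ∀ i, 0 < p (ω i) := fun i => (hp.1 _).lt_of_ne' fun h =>
    hpos.ne' (Finset.prod_eq_zero (Finset.mem_univ i) h)
  refine mul_le_mul_of_nonneg_left ?_ hω0
  rw [prod_condLaw_eq_rpow hp.1 A B hω]
  simp only [Real.rpow_lt_rpow_left_iff (show (1 : ℝ) < 2 by norm_num)]
  refine le_of_eq (if_congr ?_ rfl rfl)
  constructor <;> intro h <;> linarith

/-! ### Random linear maps -/

/-- By additivity, `v` and `v'` collide exactly when `ev (v - v')` kills the seed. The fibres of a
surjective homomorphism have equal size, so this is a fraction `1 / |D|` of the seeds. -/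
theorem isUniversal_of_surjective {Θ G D : Type*} [Fintype Θ] [AddCommGroup Θ] [AddCommGroup G]
    [Fintype D] [AddCommGroup D] (h : Θ → G →+ D) (ev : G → Θ →+ D)
    (hev : ∀ θ v, ev v θ = h θ v) (hs : ∀ v ≠ 0, Function.Surjective (ev v)) :
    IsUniversal fun θ v => h θ v := by
  classical
  intro v v' hv
  have hs' := hs (v - v') (sub_ne_zero.2 hv)
  have e : (∑ θ, if h θ v = h θ v' then (1 : ℝ) else 0) =
      (Finset.univ.filter fun θ => ev (v - v') θ = 0).card := by
    rw [Finset.sum_boole]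
    simp [sub_eq_zero, hev]
  have e2 : ∀ d, (Finset.univ.filter fun θ => ev (v - v') θ = d).card =
      (Finset.univ.filter fun θ => ev (v - v') θ = 0).card := fun d =>
    AddMonoidHom.card_fiber_eq_of_mem_range _ (hs' d) (hs' 0)
  have e3 := Finset.card_eq_sum_card_fiberwise (s := (Finset.univ : Finset Θ))
    (t := (Finset.univ : Finset D)) (f := ev (v - v'))
    fun _ _ => Finset.mem_coe.2 (Finset.mem_univ _)
  simp only [e2, Finset.sum_const, Finset.card_univ, smul_eq_mul] at e3
  rw [e3]
  push_cast
  rw [mul_comm]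
  refine le_of_eq (congrArg _ ?_)
  convert e

/-- Multiplication of a vector by a matrix, additive in both arguments. -/
def vecMatrixHom (F : Type*) [Field F] (l n : ℕ) :
    (Fin n → F) →+ Matrix (Fin l) (Fin n) F →+ (Fin l → F) where
  toFun v :=
    { toFun := fun M => M.mulVec v
      map_zero' := Matrix.zero_mulVec v
      map_add' := fun M N => Matrix.add_mulVec M N v }
  map_zero' := by ext; simp
  map_add' v w := by ext; simp [Matrix.mulVec_add]

theorem vecMatrixHom_surjective (F : Type*) [Field F] (l n : ℕ) {v : Fin n → F} (hv : v ≠ 0) :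
    Function.Surjective (vecMatrixHom F l n v) := by
  classical
  obtain ⟨j, hj⟩ := Function.ne_iff.1 hv
  intro d
  -- Each row is supported on one coordinate where `v` is nonzero; the division there uses that `F`
  -- is a field.
  refine ⟨fun i => Pi.single j (d i / v j), ?_⟩
  ext i
  change Pi.single j (d i / v j) ⬝ᵥ v = d i
  rw [single_dotProduct]
  exact div_mul_cancel₀ _ hj

/-! ### Factorization of a test channel -/

/-- Holds for null conditions as well, since the joint law is dominated by the marginal; this spares
positivity assumptions in the chain rules. -/
theorem condLaw_mul_law {Ω α β : Type*} [Fintype Ω] {p : Ω → ℝ} (hp : ∀ ω, 0 ≤ p ω) (A : Ω → α)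
    (B : Ω → β) (a : α) (b : β) :
    condLaw p A B a b * law p B b = law p (fun ω => (A ω, B ω)) (a, b) := by
  by_cases h : law p B b = 0
  · rw [h, mul_zero]
    exact le_antisymm (law_nonneg hp _ _) (h ▸ law_pair_le hp A B a b)
  · exact div_mul_cancel₀ _ h

theorem law_comp_injective {Ω α β : Type*} [Fintype Ω] (p : Ω → ℝ) (A : Ω → α) {f : α → β}
    (hf : Function.Injective f) (a : α) : law p (fun ω => f (A ω)) (f a) = law p A a := by
  classical
  simp only [law, hf.eq_iff]

theorem law_apply_of_injective {Ω α : Type*} [Fintype Ω] (p : Ω → ℝ) {A : Ω → α}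
    (hA : Function.Injective A) (ω : Ω) : law p A (A ω) = p ω := by
  classical
  simp [law, hA.eq_iff]

/-- Monotonicity under coarsening; it settles the null cases in which a Markov condition says
nothing. -/
theorem law_eq_zero_of_comp {Ω α β : Type*} [Fintype Ω] {p : Ω → ℝ} (hp : ∀ ω, 0 ≤ p ω)
    (A : Ω → α) (f : α → β) {a : α} (h : law p (fun ω => f (A ω)) (f a) = 0) :
    law p A a = 0 := by
  classical
  refine le_antisymm (h ▸ Finset.sum_le_sum fun ω _ => ?_) (law_nonneg hp A a)
  by_cases e : A ω = a
  · simp [e]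
  · rw [if_neg e]
    split_ifs <;> simp [hp]

theorem law_law_pair {Ω α β γ : Type*} [Fintype Ω] [Fintype α] (p : Ω → ℝ) (A : Ω → α)
    (B : Ω → β) (f : α → γ) (b : β) (c : γ) :
    law (fun a => law p (fun ω => (A ω, B ω)) (a, b)) f c =
      law p (fun ω => (f (A ω), B ω)) (c, b) := by
  classical
  have e : ∀ a, (if f a = c then law p (fun ω => (A ω, B ω)) (a, b) else 0) =
      ∑ ω, if A ω = a then (if f (A ω) = c ∧ B ω = b then p ω else 0) else 0 := by
    intro a
    by_cases h : f a = c
    · rw [if_pos h, law]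
      refine Finset.sum_congr rfl fun ω _ => ?_
      by_cases h' : A ω = a <;> simp [h', h]
    · rw [if_neg h]
      refine (Finset.sum_eq_zero fun ω _ => ?_).symm
      by_cases h' : A ω = a <;> simp [h', h]
  rw [law, Finset.sum_congr rfl fun a _ => e a, Finset.sum_comm]
  simp [law]

/-- Versions of the conditional pmf `p_{A|B}` that are pmfs for every condition. -/
theorem exists_condKernel {Ω α β : Type*} [Fintype Ω] [Fintype α] {p : Ω → ℝ}
    (hp : p ∈ stdSimplex ℝ Ω) (A : Ω → α) (B : Ω → β) :
    ∃ K : β → α → ℝ, (∀ b, K b ∈ stdSimplex ℝ α) ∧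
      ∀ b, law p B b ≠ 0 → ∀ a, K b a = condLaw p A B a b := by
  classical
  refine ⟨fun b => if law p B b = 0 then law p A else fun a => condLaw p A B a b, fun b => ?_,
    fun b hb a => by simp [hb]⟩
  by_cases hb : law p B b = 0
  · simpa only [hb, if_true] using law_mem_stdSimplex hp A
  · simp only [hb, if_false]
    refine ⟨fun a => div_nonneg (law_nonneg hp.1 _ _) (law_nonneg hp.1 _ _), ?_⟩
    simp only [condLaw, ← Finset.sum_div]
    rw [div_eq_one_iff_eq hb]
    have := law_law_pair p A B (fun _ => ()) b ()
    simp only [law, if_true] at this ⊢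
    simpa using this

theorem law_condKernel {Ω α β γ : Type*} [Fintype Ω] [Fintype α] {p : Ω → ℝ}
    {A : Ω → α} {B : Ω → β} {K : α → ℝ} {b : β} (hK : ∀ a, K a = condLaw p A B a b)
    (f : α → γ) (c : γ) : law K f c = condLaw p (fun ω => f (A ω)) B c b := by
  classical
  rw [condLaw, ← law_law_pair, law, law, Finset.sum_div]
  refine Finset.sum_congr rfl fun a _ => ?_
  rw [hK, condLaw]
  split_ifs <;> simp

theorem condLaw_pair_eq {Ω α α' β : Type*} [Fintype Ω] {p : Ω → ℝ} (hp : ∀ ω, 0 ≤ p ω)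
    (A : Ω → α) (A' : Ω → α') (B : Ω → β) (a : α) (a' : α') (b : β) :
    condLaw p (fun ω => (A ω, A' ω)) B (a, a') b =
      condLaw p A B a b * condLaw p A' (fun ω => (B ω, A ω)) a' (b, a) := by
  have h1 : law p (fun ω => ((A ω, A' ω), B ω)) ((a, a'), b) =
      law p (fun ω => (A' ω, B ω, A ω)) (a', b, a) :=
    (law_comp_injective p (fun ω => ((A ω, A' ω), B ω)) (f := fun i => (i.1.2, i.2, i.1.1))
      (by rintro ⟨⟨_, _⟩, _⟩ ⟨⟨_, _⟩, _⟩ h; simp_all) ((a, a'), b)).symm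
  have h2 : law p (fun ω => (A ω, B ω)) (a, b) = law p (fun ω => (B ω, A ω)) (b, a) :=
    (law_comp_injective p (fun ω => (A ω, B ω)) Prod.swap_injective (a, b)).symm
  rw [condLaw, h1, ← condLaw_mul_law hp,
    show condLaw p A B a b = law p (fun ω => (B ω, A ω)) (b, a) / law p B b by rw [condLaw, h2]]
  ring

section

variable {S₁ S₂ X₁ X₂ Y : Type*} [Fintype S₁] [Fintype S₂] [Fintype X₁] [Fintype X₂] [Fintype Y]

/-- Chain rule in the order `s, u₂, u₁, x₂, x₁, y`: each Markov condition strips one factor of its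
remote arguments, and where its conditioning event is null both sides vanish. -/
theorem IsTestChannel.eq_mul {U : Type*} [Fintype U] {ch : MACDSTx S₁ S₂ X₁ X₂ Y} {τ : ℝ × ℝ}
    {p : Outcome U S₁ S₂ X₁ X₂ Y → ℝ} (h : IsTestChannel ch τ p) (ω : Outcome U S₁ S₂ X₁ X₂ Y)
    (hs : ch.WS ω.s ≠ 0) :
    p ω = ch.WS ω.s *
      (condLaw p (fun ω => (ω.u₁, ω.x₁)) (fun ω => ω.s₁) (ω.u₁, ω.x₁) ω.s₁ *
        condLaw p (fun ω => (ω.u₂, ω.x₂)) (fun ω => ω.s₂) (ω.u₂, ω.x₂) ω.s₂) *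
      ch.W ω.x₁ ω.x₂ ω.s₁ ω.s₂ ω.y := by
  have hp := h.pmf.1
  obtain ⟨⟨u₁, u₂⟩, ⟨s₁, s₂⟩, ⟨x₁, x₂⟩, y⟩ := ω
  simp only [Outcome.u₁, Outcome.u₂, Outcome.s₁, Outcome.s₂, Outcome.x₁, Outcome.x₂,
    Outcome.y, Outcome.s] at hs ⊢
  rw [condLaw_pair_eq hp, condLaw_pair_eq hp]
  rw [← h.state (s₁, s₂)] at hs ⊢
  have hsu₂ : law p (fun ω => (ω.2.1, ω.1.2)) ((s₁, s₂), u₂) =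
      condLaw p (fun ω => ω.1.2) (fun ω => ω.2.1.2) u₂ s₂ * law p (fun ω => ω.2.1) (s₁, s₂) := by
    rw [← h.aux₂ u₂ (s₁, s₂) hs, condLaw_mul_law hp]
    exact (law_comp_injective p (fun ω : Outcome U S₁ S₂ X₁ X₂ Y => (ω.2.1, ω.1.2))
      Prod.swap_injective ((s₁, s₂), u₂)).symm
  have hsu : law p (fun ω => (ω.2.1, ω.1)) ((s₁, s₂), (u₁, u₂)) =
      condLaw p (fun ω => ω.1.1) (fun ω => ω.2.1.1) u₁ s₁ *
        (condLaw p (fun ω => ω.1.2) (fun ω => ω.2.1.2) u₂ s₂ *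
          law p (fun ω => ω.2.1) (s₁, s₂)) := by
    rw [← hsu₂]
    have e : law p (fun ω => (ω.2.1, ω.1)) ((s₁, s₂), (u₁, u₂)) =
        law p (fun ω => (ω.1.1, ω.2.1, ω.1.2)) (u₁, (s₁, s₂), u₂) :=
      (law_comp_injective p (fun ω : Outcome U S₁ S₂ X₁ X₂ Y => (ω.2.1, ω.1))
        (f := fun i => (i.2.1, i.1, i.2.2))
        (by rintro ⟨_, _, _⟩ ⟨_, _, _⟩ h; simp_all) ((s₁, s₂), (u₁, u₂))).symm
    rw [e]
    by_cases h0 : law p (fun ω => (ω.2.1, ω.1.2)) ((s₁, s₂), u₂) = 0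
    · rw [h0, mul_zero]
      exact law_eq_zero_of_comp hp (fun ω : Outcome U S₁ S₂ X₁ X₂ Y => (ω.1.1, ω.2.1, ω.1.2))
        Prod.snd h0
    · rw [← h.aux₁ u₁ (s₁, s₂) hs, ← h.aux₁_fine u₁ u₂ (s₁, s₂) h0, condLaw_mul_law hp]
  have hy : p ((u₁, u₂), (s₁, s₂), (x₁, x₂), y) = ch.W x₁ x₂ s₁ s₂ y *
      law p (fun ω => (ω.2.2.1, ω.2.1, ω.1)) ((x₁, x₂), (s₁, s₂), (u₁, u₂)) := by
    have e : law p (fun ω => (ω.2.2.2, ω.2.2.1, ω.2.1, ω.1))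
        (y, (x₁, x₂), (s₁, s₂), (u₁, u₂)) = p ((u₁, u₂), (s₁, s₂), (x₁, x₂), y) :=
      law_apply_of_injective p (A := fun ω : Outcome U S₁ S₂ X₁ X₂ Y =>
        (ω.2.2.2, ω.2.2.1, ω.2.1, ω.1)) (by rintro ⟨_, _, _, _⟩ ⟨_, _, _, _⟩ h; simp_all)
        ((u₁, u₂), (s₁, s₂), (x₁, x₂), y)
    by_cases h0 : law p (fun ω => (ω.2.2.1, ω.2.1, ω.1)) ((x₁, x₂), (s₁, s₂), (u₁, u₂)) = 0
    · rw [h0, mul_zero, ← e]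
      exact law_eq_zero_of_comp hp (fun ω : Outcome U S₁ S₂ X₁ X₂ Y =>
        (ω.2.2.2, ω.2.2.1, ω.2.1, ω.1)) Prod.snd h0
    · rw [← h.output_fine (x₁, x₂) (s₁, s₂) (u₁, u₂) y h0, ← e, condLaw_mul_law hp]
  -- If `(s, u)` is null although `s` is not, one of the two auxiliary factors is zero, so the
  -- right-hand side vanishes too.
  by_cases h0 : law p (fun ω => (ω.2.1, ω.1)) ((s₁, s₂), (u₁, u₂)) = 0
  · have : law p (fun ω => (ω.2.2.1, ω.2.1, ω.1)) ((x₁, x₂), (s₁, s₂), (u₁, u₂)) = 0 :=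
      law_eq_zero_of_comp hp (fun ω : Outcome U S₁ S₂ X₁ X₂ Y => (ω.2.2.1, ω.2.1, ω.1))
        Prod.snd h0
    rw [hy, this]
    rw [hsu] at h0
    have h0' : condLaw p (fun ω => ω.1.1) (fun ω => ω.2.1.1) u₁ s₁ = 0 ∨
        condLaw p (fun ω => ω.1.2) (fun ω => ω.2.1.2) u₂ s₂ = 0 := by simpa [hs] using h0
    rcases h0' with e | e <;> rw [e] <;> ring
  have hx₂ : law p (fun ω => (ω.2.1, ω.1, ω.2.2.1.2)) ((s₁, s₂), (u₁, u₂), x₂) =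
      condLaw p (fun ω => ω.2.2.1.2) (fun ω => (ω.2.1.2, ω.1.2)) x₂ (s₂, u₂) *
        law p (fun ω => (ω.2.1, ω.1)) ((s₁, s₂), (u₁, u₂)) := by
    rw [← h.input₂ x₂ (s₁, s₂) (u₁, u₂) h0, condLaw_mul_law hp]
    exact (law_comp_injective p (fun ω : Outcome U S₁ S₂ X₁ X₂ Y => (ω.2.1, ω.1, ω.2.2.1.2))
      (f := fun i => (i.2.2, i.1, i.2.1))
      (by rintro ⟨_, _, _⟩ ⟨_, _, _⟩ h; simp_all) ((s₁, s₂), (u₁, u₂), x₂)).symm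
  have hx : law p (fun ω => (ω.2.2.1, ω.2.1, ω.1)) ((x₁, x₂), (s₁, s₂), (u₁, u₂)) =
      condLaw p (fun ω => ω.2.2.1.1) (fun ω => (ω.2.1.1, ω.1.1)) x₁ (s₁, u₁) *
      law p (fun ω => (ω.2.1, ω.1, ω.2.2.1.2)) ((s₁, s₂), (u₁, u₂), x₂) := by
    have e : law p (fun ω => (ω.2.2.1, ω.2.1, ω.1)) ((x₁, x₂), (s₁, s₂), (u₁, u₂)) =
        law p (fun ω => (ω.2.2.1.1, ω.2.1, ω.1, ω.2.2.1.2)) (x₁, (s₁, s₂), (u₁, u₂), x₂) :=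
      (law_comp_injective p (fun ω : Outcome U S₁ S₂ X₁ X₂ Y => (ω.2.2.1, ω.2.1, ω.1))
        (f := fun i => (i.1.1, i.2.1, i.2.2, i.1.2))
        (by rintro ⟨⟨_, _⟩, _, _⟩ ⟨⟨_, _⟩, _, _⟩ h; simp_all)
        ((x₁, x₂), (s₁, s₂), (u₁, u₂))).symm
    rw [e]
    by_cases h1 : law p (fun ω => (ω.2.1, ω.1, ω.2.2.1.2)) ((s₁, s₂), (u₁, u₂), x₂) = 0
    · rw [h1, mul_zero]
      exact law_eq_zero_of_comp hp
        (fun ω : Outcome U S₁ S₂ X₁ X₂ Y => (ω.2.2.1.1, ω.2.1, ω.1, ω.2.2.1.2)) Prod.snd h1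
    · rw [← h.input₁ x₁ (s₁, s₂) (u₁, u₂) h0, ← h.input₁_fine x₁ x₂ (s₁, s₂) (u₁, u₂) h1,
        condLaw_mul_law hp]
  rw [hy, hx, hx₂, hsu]
  ring

/-- A test channel is the composition of the state law, two local encoders and the channel. -/
theorem IsTestChannel.exists_factorization {U : Type*} [Fintype U]
    {ch : MACDSTx S₁ S₂ X₁ X₂ Y} {τ : ℝ × ℝ} {p : Outcome U S₁ S₂ X₁ X₂ Y → ℝ}
    (h : IsTestChannel ch τ p) :
    ∃ (A₁ : S₁ → U × X₁ → ℝ) (A₂ : S₂ → U × X₂ → ℝ),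
      (∀ s, A₁ s ∈ stdSimplex ℝ (U × X₁)) ∧ (∀ s, A₂ s ∈ stdSimplex ℝ (U × X₂)) ∧
      (∀ ω, p ω = ch.WS ω.s * (A₁ ω.s₁ (ω.u₁, ω.x₁) * A₂ ω.s₂ (ω.u₂, ω.x₂)) *
        ch.W ω.x₁ ω.x₂ ω.s₁ ω.s₂ ω.y) ∧
      (∀ s, law p (fun ω => ω.s₁) s ≠ 0 → ∀ u, law (A₁ s) Prod.fst u =
        condLaw p (fun ω => ω.u₁) (fun ω => ω.s₁) u s) ∧
      (∀ s, law p (fun ω => ω.s₂) s ≠ 0 → ∀ u, law (A₂ s) Prod.fst u =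
        condLaw p (fun ω => ω.u₂) (fun ω => ω.s₂) u s) := by
  have hp := h.pmf.1
  obtain ⟨A₁, hA₁, e₁⟩ := exists_condKernel h.pmf (fun ω => (ω.u₁, ω.x₁)) (fun ω => ω.s₁)
  obtain ⟨A₂, hA₂, e₂⟩ := exists_condKernel h.pmf (fun ω => (ω.u₂, ω.x₂)) (fun ω => ω.s₂)
  refine ⟨A₁, A₂, hA₁, hA₂, fun ω => ?_, fun s hs u => law_condKernel (e₁ s hs) Prod.fst u,
    fun s hs u => law_condKernel (e₂ s hs) Prod.fst u⟩
  -- On null states the kernels are arbitrary, but `p ω` and the state factor are both zero.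
  by_cases hs : ch.WS ω.s = 0
  · rw [hs, zero_mul, zero_mul]
    rw [← h.state ω.s] at hs
    by_contra hne
    exact (law_pos hp (fun ω => ω.s) ((hp ω).lt_of_ne' hne)).ne' hs
  · have hs' := hs
    rw [← h.state ω.s] at hs'
    rw [h.eq_mul ω hs, e₁ ω.s₁ (fun h0 => hs' (law_eq_zero_of_comp hp (fun ω => ω.s) Prod.fst h0)),
      e₂ ω.s₂ (fun h0 => hs' (law_eq_zero_of_comp hp (fun ω => ω.s) Prod.snd h0))]

end

/-- Expectations under the `n`-fold product of a factorized law. -/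
theorem sum_pi_factorization {S₁ S₂ X₁ X₂ Y : Type*} [Fintype S₁] [Fintype S₂]
    [Fintype X₁] [Fintype X₂] [Fintype Y] {U : Type*} [Fintype U] {p : Outcome U S₁ S₂ X₁ X₂ Y → ℝ}
    {W : S₁ × S₂ → ℝ} {A₁ : S₁ → U × X₁ → ℝ} {A₂ : S₂ → U × X₂ → ℝ}
    {N : X₁ → X₂ → S₁ → S₂ → Y → ℝ}
    (hp : ∀ ω, p ω = W ω.s * (A₁ ω.s₁ (ω.u₁, ω.x₁) * A₂ ω.s₂ (ω.u₂, ω.x₂)) *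
        N ω.x₁ ω.x₂ ω.s₁ ω.s₂ ω.y) {n : ℕ}
    (φ : (Fin n → S₁) → (Fin n → S₂) → (Fin n → U × X₁) → (Fin n → U × X₂) → (Fin n → Y) → ℝ) :
    ∑ ω : Fin n → Outcome U S₁ S₂ X₁ X₂ Y, (∏ i, p (ω i)) *
      φ (fun i => (ω i).s₁) (fun i => (ω i).s₂) (fun i => ((ω i).u₁, (ω i).x₁))
        (fun i => ((ω i).u₂, (ω i).x₂)) (fun i => (ω i).y) =
    ∑ s₁, ∑ s₂, (∏ i, W (s₁ i, s₂ i)) * ∑ b₁, ∑ b₂,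
      (∏ i, A₁ (s₁ i) (b₁ i)) * (∏ i, A₂ (s₂ i) (b₂ i)) *
        ∑ y, (∏ i, N (b₁ i).2 (b₂ i).2 (s₁ i) (s₂ i) (y i)) * φ s₁ s₂ b₁ b₂ y := by
  simp only [Finset.mul_sum]
  simp only [← Fintype.sum_prod_type']
  -- A word of tuples is regrouped as a tuple of words.
  refine Fintype.sum_equiv
    { toFun := fun (ω : Fin n → Outcome U S₁ S₂ X₁ X₂ Y) => (fun i => (ω i).s₁, fun i => (ω i).s₂, fun i => ((ω i).u₁, (ω i).x₁),
        fun i => ((ω i).u₂, (ω i).x₂), fun i => (ω i).y)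
      invFun := fun z i => (((z.2.2.1 i).1, (z.2.2.2.1 i).1), (z.1 i, z.2.1 i),
        ((z.2.2.1 i).2, (z.2.2.2.1 i).2), z.2.2.2.2 i)
      left_inv := fun _ => rfl
      right_inv := fun _ => rfl } _ _ fun ω => ?_
  simp only [Equiv.coe_fn_mk, hp, Finset.prod_mul_distrib]
  ring

/-! ### From encoding and decoding maps to codes. -/

theorem MACDSTx.sum_prod_WS₁ {S₁ S₂ X₁ X₂ Y : Type*} [Fintype S₁] [Fintype S₂]
    [Fintype Y] (ch : MACDSTx S₁ S₂ X₁ X₂ Y) {n : ℕ} (F : (Fin n → S₁) → ℝ) :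
    ∑ s₁ : Fin n → S₁, (∏ i, ch.WS₁ (s₁ i)) * F s₁ =
      ∑ s₁ : Fin n → S₁, ∑ s₂ : Fin n → S₂, (∏ i, ch.WS (s₁ i, s₂ i)) * F s₁ := by
  refine Finset.sum_congr rfl fun s₁ _ => ?_
  rw [← Finset.sum_mul, sum_pi_prod fun i s₂ => ch.WS (s₁ i, s₂)]
  rfl

theorem MACDSTx.sum_prod_WS₂ {S₁ S₂ X₁ X₂ Y : Type*} [Fintype S₁] [Fintype S₂]
    [Fintype Y] (ch : MACDSTx S₁ S₂ X₁ X₂ Y) {n : ℕ} (F : (Fin n → S₂) → ℝ) :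
    ∑ s₂ : Fin n → S₂, (∏ i, ch.WS₂ (s₂ i)) * F s₂ =
      ∑ s₁ : Fin n → S₁, ∑ s₂ : Fin n → S₂, (∏ i, ch.WS (s₁ i, s₂ i)) * F s₂ := by
  rw [Finset.sum_comm]
  refine Finset.sum_congr rfl fun s₂ _ => ?_
  rw [← Finset.sum_mul, sum_pi_prod fun i s₁ => ch.WS (s₁, s₂ i)]
  rfl

theorem MACDSTx.WS₁_mem {S₁ S₂ X₁ X₂ Y : Type*} [Fintype S₁] [Fintype S₂]
    [Fintype Y] (ch : MACDSTx S₁ S₂ X₁ X₂ Y) : ch.WS₁ ∈ stdSimplex ℝ S₁ :=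
  ⟨fun _ => Finset.sum_nonneg fun _ _ => ch.WS_mem.1 _, by
    rw [← ch.WS_mem.2, Fintype.sum_prod_type]; rfl⟩

theorem MACDSTx.WS₂_mem {S₁ S₂ X₁ X₂ Y : Type*} [Fintype S₁] [Fintype S₂]
    [Fintype Y] (ch : MACDSTx S₁ S₂ X₁ X₂ Y) : ch.WS₂ ∈ stdSimplex ℝ S₂ :=
  ⟨fun _ => Finset.sum_nonneg fun _ _ => ch.WS_mem.1 _, by
    rw [← ch.WS_mem.2, Fintype.sum_prod_type, Finset.sum_comm]; rfl⟩

open scoped Classical in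
/-- A bound on the average cost by the probability of exceeding a threshold. -/
theorem sum_mul_cost_le {I S B : Type*} [Fintype I] [Nonempty I] [Fintype S] {w : S → ℝ}
    (hw : w ∈ stdSimplex ℝ S) (κ : S → B → ℝ) {T K δ : ℝ} (hK0 : 0 ≤ K) (hT : 0 ≤ T)
    (hK : ∀ s b, κ s b ≤ K)
    (f : I → S → B)
    (h : ∑ m, ∑ s, w s * (if T < κ s (f m s) then 1 else 0) ≤ Fintype.card I * δ) :
    (∑ m, ∑ s, w s * κ s (f m s)) / Fintype.card I ≤ T + K * δ := by
  have hI : (0 : ℝ) < Fintype.card I := by exact_mod_cast Fintype.card_pos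
  rw [div_le_iff₀ hI]
  calc ∑ m, ∑ s, w s * κ s (f m s)
      -- Pointwise, a cost bounded by `K` is at most `T`, plus `K` on the event that `T` is
      -- exceeded.
      ≤ ∑ m : I, ∑ s, (w s * T + K * (w s * (if T < κ s (f m s) then 1 else 0))) := by
        refine Finset.sum_le_sum fun m _ => Finset.sum_le_sum fun s _ => ?_
        rw [mul_left_comm, ← mul_add]
        refine mul_le_mul_of_nonneg_left ?_ (hw.1 s)
        split_ifs with hlt
        · linarith [hK s (f m s)]
        · linarith
    _ = Fintype.card I * T + K * ∑ m, ∑ s, w s * (if T < κ s (f m s) then 1 else 0) := by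
        simp only [Finset.sum_add_distrib, ← Finset.mul_sum, ← Finset.sum_mul, hw.2, one_mul,
          Finset.sum_const, Finset.card_univ, nsmul_eq_mul]
    _ ≤ Fintype.card I * T + K * (Fintype.card I * δ) := by gcongr
    _ = _ := by ring

theorem sum_div_le_of_forall_le {n : ℕ} (hn : 0 < n) {κ : Fin n → ℝ} {K : ℝ}
    (h : ∀ i, κ i ≤ K) : (∑ i, κ i) / n ≤ K := by
  have hn' : (0 : ℝ) < n := by exact_mod_cast hn
  rw [div_le_iff₀ hn']
  calc ∑ i, κ i ≤ ∑ _i : Fin n, K := Finset.sum_le_sum fun i _ => h i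
    _ = K * n := by simp [mul_comm]

open scoped Classical in
/-- Encoding and decoding maps with a small total probability of decoding errors and of large
costs make up a good code. -/
theorem MACDSTx.exists_code_of_maps {S₁ S₂ X₁ X₂ Y : Type*} [Fintype S₁] [Fintype S₂] [Fintype Y]
    (ch : MACDSTx S₁ S₂ X₁ X₂ Y) {E₁ E₂ : Type*} [Fintype E₁] [Nonempty E₁] [Fintype E₂]
    [Nonempty E₂] {n : ℕ} (hn : 0 < n) (f₁ : E₁ → (Fin n → S₁) → (Fin n → X₁))
    (f₂ : E₂ → (Fin n → S₂) → (Fin n → X₂)) (dec : (Fin n → Y) → E₁ × E₂) {T₁ T₂ K δ : ℝ}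
    (hT₁ : 0 ≤ T₁) (hT₂ : 0 ≤ T₂) (hK : 0 ≤ K)
    (hK₁ : ∀ x s, ch.κ₁ x s ≤ K) (hK₂ : ∀ x s, ch.κ₂ x s ≤ K)
    (hδ : ∑ m₁, ∑ m₂, ∑ s₁ : Fin n → S₁, ∑ s₂ : Fin n → S₂, (∏ i, ch.WS (s₁ i, s₂ i)) *
      ((∑ y, if dec y = (m₁, m₂) then 0 else
        ∏ i, ch.W (f₁ m₁ s₁ i) (f₂ m₂ s₂ i) (s₁ i) (s₂ i) (y i)) +
        (if T₁ < (∑ i, ch.κ₁ (f₁ m₁ s₁ i) (s₁ i)) / n then 1 else 0) +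
        (if T₂ < (∑ i, ch.κ₂ (f₂ m₂ s₂ i) (s₂ i)) / n then 1 else 0)) ≤
      Fintype.card E₁ * Fintype.card E₂ * δ) :
    ∃ c : MACCode S₁ S₂ X₁ X₂ Y n (Fintype.card E₁) (Fintype.card E₂),
      ch.avgErrorProb c ≤ δ ∧ ch.avgCost₁ c ≤ T₁ + K * δ ∧ ch.avgCost₂ c ≤ T₂ + K * δ := by
  have h₁ : (0 : ℝ) < Fintype.card E₁ := by exact_mod_cast Fintype.card_pos
  have h₂ : (0 : ℝ) < Fintype.card E₂ := by exact_mod_cast Fintype.card_pos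
  have hW : ∀ (s₁ : Fin n → S₁) (s₂ : Fin n → S₂), 0 ≤ ∏ i, ch.WS (s₁ i, s₂ i) :=
    fun s₁ s₂ => Finset.prod_nonneg fun i _ => ch.WS_mem.1 _
  have herr : ∀ m₁ m₂ s₁ s₂, 0 ≤ ∑ y, if dec y = (m₁, m₂) then 0 else
        ∏ i, ch.W (f₁ m₁ s₁ i) (f₂ m₂ s₂ i) (s₁ i) (s₂ i) (y i) := by
    intro m₁ m₂ s₁ s₂
    refine Finset.sum_nonneg fun y _ => ?_
    split_ifs
    exacts [le_rfl, Finset.prod_nonneg fun i _ => (ch.W_mem ..).1 _]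
  have hind : ∀ q : Prop, 0 ≤ if q then (1 : ℝ) else 0 := fun q => by split_ifs <;> norm_num
  set e₁ := Fintype.equivFin E₁
  set e₂ := Fintype.equivFin E₂
  refine ⟨⟨fun m => f₁ (e₁.symm m), fun m => f₂ (e₂.symm m),
    fun y => (e₁ (dec y).1, e₂ (dec y).2)⟩, ?_, ?_, ?_⟩
  · rw [MACDSTx.avgErrorProb, div_le_iff₀ (mul_pos h₁ h₂), mul_comm]
    refine le_trans ?_ hδ
    rw [← e₁.symm.sum_comp]
    refine Finset.sum_le_sum fun m₁ _ => ?_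
    rw [← e₂.symm.sum_comp]
    refine Finset.sum_le_sum fun m₂ _ => Finset.sum_le_sum fun s₁ _ =>
      Finset.sum_le_sum fun s₂ _ => mul_le_mul_of_nonneg_left ?_ (hW s₁ s₂)
    rw [add_assoc]
    refine le_add_of_le_of_nonneg (le_of_eq ?_) (add_nonneg (hind _) (hind _))
    refine Finset.sum_congr rfl fun y _ => if_congr ?_ rfl rfl
    simp only [Prod.ext_iff, Equiv.eq_symm_apply]
  · have := sum_mul_cost_le (pi_mem_stdSimplex fun _ : Fin n => ch.WS₁_mem)
      (fun s (b : Fin n → X₁) => (∑ i, ch.κ₁ (b i) (s i)) / n) hK hT₁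
      (fun s b => sum_div_le_of_forall_le hn fun i => hK₁ _ _) f₁ (δ := δ) (by
        -- User 1's cost does not depend on `m₂`, so summing over `m₂` only multiplies by `|E₂|`,
        -- matching the double sum in `hδ`.
        rw [← mul_le_mul_iff_of_pos_left h₂]
        refine le_trans ?_ (hδ.trans_eq (by ring))
        rw [Finset.mul_sum]
        refine Finset.sum_le_sum fun m₁ _ => ?_
        rw [ch.sum_prod_WS₁ fun s₁ => if T₁ < (∑ i, ch.κ₁ (f₁ m₁ s₁ i) (s₁ i)) / n then 1 else 0,
          ← nsmul_eq_mul, ← Finset.card_univ, ← Finset.sum_const]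
        refine Finset.sum_le_sum fun m₂ _ => Finset.sum_le_sum fun s₁ _ =>
          Finset.sum_le_sum fun s₂ _ => mul_le_mul_of_nonneg_left ?_ (hW s₁ s₂)
        linarith [herr m₁ m₂ s₁ s₂, hind (T₂ < (∑ i, ch.κ₂ (f₂ m₂ s₂ i) (s₂ i)) / n)])
    refine le_trans (le_of_eq ?_) this
    rw [MACDSTx.avgCost₁, ← e₁.symm.sum_comp]
    rfl
  · have := sum_mul_cost_le (pi_mem_stdSimplex fun _ : Fin n => ch.WS₂_mem)
      (fun s (b : Fin n → X₂) => (∑ i, ch.κ₂ (b i) (s i)) / n) hK hT₂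
      (fun s b => sum_div_le_of_forall_le hn fun i => hK₂ _ _) f₂ (δ := δ) (by
        rw [← mul_le_mul_iff_of_pos_left h₁]
        rw [Finset.sum_comm] at hδ
        refine le_trans ?_ (hδ.trans_eq (by ring))
        rw [Finset.mul_sum]
        refine Finset.sum_le_sum fun m₂ _ => ?_
        rw [ch.sum_prod_WS₂ fun s₂ => if T₂ < (∑ i, ch.κ₂ (f₂ m₂ s₂ i) (s₂ i)) / n then 1 else 0,
          ← nsmul_eq_mul, ← Finset.card_univ, ← Finset.sum_const]
        refine Finset.sum_le_sum fun m₁ _ => Finset.sum_le_sum fun s₁ _ =>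
          Finset.sum_le_sum fun s₂ _ => mul_le_mul_of_nonneg_left ?_ (hW s₁ s₂)
        linarith [herr m₁ m₂ s₁ s₂, hind (T₁ < (∑ i, ch.κ₁ (f₁ m₁ s₁ i) (s₁ i)) / n)])
    refine le_trans (le_of_eq ?_) this
    rw [MACDSTx.avgCost₂, ← e₂.symm.sum_comp]
    rfl

/-! ### Universal families of linear maps. -/

/-- The idle seed component `Θ` lets this map share a seed with further hashes. -/
theorem isUniversal_mulVec (F : Type*) [Field F] [Fintype F] (l n : ℕ) (Θ : Type*) [Fintype Θ]
    [AddCommGroup Θ] :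
    IsUniversal fun (θ : Matrix (Fin l) (Fin n) F × Θ) (v : Fin n → F) =>
      (vecMatrixHom F l n).flip θ.1 v := by
  have hs : ∀ v : Fin n → F, v ≠ 0 → Function.Surjective ((vecMatrixHom F l n v).comp
      (AddMonoidHom.fst (Matrix (Fin l) (Fin n) F) Θ)) := by
    intro v hv d
    obtain ⟨M, hM⟩ := vecMatrixHom_surjective F l n hv d
    exact ⟨(M, 0), hM⟩
  have := isUniversal_of_surjective (fun θ : Matrix (Fin l) (Fin n) F × Θ =>
    (vecMatrixHom F l n).flip θ.1)
    (fun v => (vecMatrixHom F l n v).comp (AddMonoidHom.fst _ _)) (fun _ _ => rfl) hs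
  exact this

theorem isUniversal_mulVec₃ (F : Type*) [Field F] [Fintype F] (l₀ l₁ l₂ n : ℕ) :
    IsUniversal fun (θ : Matrix (Fin l₀) (Fin n) F × Matrix (Fin l₁) (Fin n) F ×
      Matrix (Fin l₂) (Fin n) F) (v : Fin n → F) =>
        ((vecMatrixHom F l₀ n).flip θ.1 v, (vecMatrixHom F l₁ n).flip θ.2.1 v,
          (vecMatrixHom F l₂ n).flip θ.2.2 v) := by
  have hs : ∀ v : Fin n → F, v ≠ 0 → Function.Surjective ((vecMatrixHom F l₀ n v).prodMap
      ((vecMatrixHom F l₁ n v).prodMap (vecMatrixHom F l₂ n v))) := by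
    intro v hv d
    obtain ⟨M₀, h₀⟩ := vecMatrixHom_surjective F l₀ n hv d.1
    obtain ⟨M₁, h₁⟩ := vecMatrixHom_surjective F l₁ n hv d.2.1
    obtain ⟨M₂, h₂⟩ := vecMatrixHom_surjective F l₂ n hv d.2.2
    exact ⟨(M₀, M₁, M₂), Prod.ext h₀ (Prod.ext h₁ h₂)⟩
  have := isUniversal_of_surjective (fun θ : Matrix (Fin l₀) (Fin n) F ×
      Matrix (Fin l₁) (Fin n) F × Matrix (Fin l₂) (Fin n) F =>
      ((vecMatrixHom F l₀ n).flip θ.1).prod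
        (((vecMatrixHom F l₁ n).flip θ.2.1).prod ((vecMatrixHom F l₂ n).flip θ.2.2)))
    (fun v => (vecMatrixHom F l₀ n v).prodMap
      ((vecMatrixHom F l₁ n v).prodMap (vecMatrixHom F l₂ n v))) (fun _ _ => rfl) hs
  exact this

universe u in
-- One seed serves both purposes: `h₀` alone must be universal for binning the sum, the whole triple
-- for near-uniformity of the indices.
theorem exists_universal_linear (F : Type u) [Field F] [Fintype F] (l₀ l₁ l₂ n : ℕ) :
    ∃ (Θ : Type u) (_ : Fintype Θ) (_ : Nonempty Θ) (h₀ : Θ → (Fin n → F) →+ (Fin l₀ → F))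
      (h₁ : Θ → (Fin n → F) →+ (Fin l₁ → F)) (h₂ : Θ → (Fin n → F) →+ (Fin l₂ → F)),
      IsUniversal (fun θ v => h₀ θ v) ∧ IsUniversal fun θ v => (h₀ θ v, h₁ θ v, h₂ θ v) :=
  ⟨Matrix (Fin l₀) (Fin n) F × Matrix (Fin l₁) (Fin n) F × Matrix (Fin l₂) (Fin n) F,
    inferInstance, inferInstance, fun θ => (vecMatrixHom F l₀ n).flip θ.1,
    fun θ => (vecMatrixHom F l₁ n).flip θ.2.1, fun θ => (vecMatrixHom F l₂ n).flip θ.2.2,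
    isUniversal_mulVec F l₀ n _, isUniversal_mulVec₃ F l₀ l₁ l₂ n⟩

/-! ### Block codes and achievability. -/

/-- Block codes of arbitrary dimensions for a test channel. -/
theorem IsTestChannel.exists_block_code {S₁ S₂ X₁ X₂ Y : Type*} [Fintype S₁] [Fintype S₂]
    [Fintype X₁] [Fintype X₂] [Fintype Y] {V : Type*} [Field V] [Fintype V]
    {ch : MACDSTx S₁ S₂ X₁ X₂ Y} {τ : ℝ × ℝ} {p : Outcome V S₁ S₂ X₁ X₂ Y → ℝ}
    (h : IsTestChannel ch τ p) (hτ₁ : 0 ≤ τ.1) (hτ₂ : 0 ≤ τ.2) {ε K : ℝ} (hε : 0 < ε) (hK : 0 ≤ K)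
    (hK₁ : ∀ x s, ch.κ₁ x s ≤ K) (hK₂ : ∀ x s, ch.κ₂ x s ≤ K) :
    ∃ C : ℝ, ∀ (n l₀ l₁ l₂ : ℕ) (E : ℝ), 0 < n →
      C / n + 2 ^ (n * (condEntropy p (fun ω => ω.u₁ + ω.u₂) (fun ω => ω.y) + ε)) /
            (Fintype.card V : ℝ) ^ l₀ +
          3 * (√((Fintype.card V : ℝ) ^ (l₀ + l₁ + l₂) *
              2 ^ (-(n * (condEntropy p (fun ω => ω.u₁) (fun ω => ω.s₁) - ε)))) +
            √((Fintype.card V : ℝ) ^ (l₀ + l₁ + l₂) *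
              2 ^ (-(n * (condEntropy p (fun ω => ω.u₂) (fun ω => ω.s₂) - ε))))) ≤ E →
      ∃ c : MACCode S₁ S₂ X₁ X₂ Y n (Fintype.card (Fin l₁ → V)) (Fintype.card (Fin l₂ → V)),
        ch.avgErrorProb c ≤ E ∧ ch.avgCost₁ c ≤ τ.1 + ε + K * E ∧
          ch.avgCost₂ c ≤ τ.2 + ε + K * E := by
  classical
  obtain ⟨A₁, A₂, hA₁, hA₂, hp, hm₁, hm₂⟩ := h.exists_factorization
  set Z₁ : Outcome V S₁ S₂ X₁ X₂ Y → ℝ := fun ω => ch.κ₁ ω.x₁ ω.s₁ with hZ₁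
  set Z₂ : Outcome V S₁ S₂ X₁ X₂ Y → ℝ := fun ω => ch.κ₂ ω.x₂ ω.s₂ with hZ₂
  set I₀ := condInfo p (fun ω => ω.u₁ + ω.u₂) (fun ω => ω.y) with hI₀
  set I₁ := condInfo p (fun ω => ω.u₁) (fun ω => ω.s₁) with hI₁
  set I₂ := condInfo p (fun ω => ω.u₂) (fun ω => ω.s₂) with hI₂
  set H₀ := condEntropy p (fun ω => ω.u₁ + ω.u₂) (fun ω => ω.y) with hH₀
  set H₁ := condEntropy p (fun ω => ω.u₁) (fun ω => ω.s₁) with hH₁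
  set H₂ := condEntropy p (fun ω => ω.u₂) (fun ω => ω.s₂) with hH₂
  -- The Chebyshev constants of the five tail events; the factor 6 is the cost bound 3 times the 2
  -- of `leftover_hash`.
  set C := expect p (fun ω => (Z₁ ω - expect p Z₁) ^ 2) / ε ^ 2 +
    expect p (fun ω => (Z₂ ω - expect p Z₂) ^ 2) / ε ^ 2 +
    expect p (fun ω => (I₀ ω - H₀) ^ 2) / ε ^ 2 +
    6 * (expect p (fun ω => (I₁ ω - H₁) ^ 2) / ε ^ 2) +
    6 * (expect p (fun ω => (I₂ ω - H₂) ^ 2) / ε ^ 2) with hC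
  refine ⟨C, fun n l₀ l₁ l₂ E hn hE => ?_⟩
  have hn' : (0 : ℝ) < n := by exact_mod_cast hn
  set P : (Fin n → Outcome V S₁ S₂ X₁ X₂ Y) → ℝ := fun ω => ∏ i, p (ω i) with hP
  have hPm : P ∈ stdSimplex ℝ _ := pi_mem_stdSimplex fun _ => h.pmf
  have hfac : ∀ φ : (Fin n → S₁) → (Fin n → S₂) → (Fin n → V × X₁) → (Fin n → V × X₂) →
      (Fin n → Y) → ℝ, ∑ ω, P ω * φ (fun i => (ω i).s₁) (fun i => (ω i).s₂)
        (fun i => ((ω i).u₁, (ω i).x₁)) (fun i => ((ω i).u₂, (ω i).x₂)) (fun i => (ω i).y) =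
      ∑ s₁, ∑ s₂, (∏ i, ch.WS (s₁ i, s₂ i)) * ∑ b₁, ∑ b₂,
        (∏ i, A₁ (s₁ i) (b₁ i)) * (∏ i, A₂ (s₂ i) (b₂ i)) *
          ∑ y, (∏ i, ch.W (b₁ i).2 (b₂ i).2 (s₁ i) (s₂ i) (y i)) * φ s₁ s₂ b₁ b₂ y :=
    fun φ => sum_pi_factorization hp φ
  obtain ⟨Θ, _, _, h₀, h₁, h₂, hu₀, hu⟩ := exists_universal_linear V l₀ l₁ l₂ n
  obtain ⟨f₁, f₂, dec, hcode⟩ := exists_code hu₀ hu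
    (W := fun (s₁ : Fin n → S₁) (s₂ : Fin n → S₂) => ∏ i, ch.WS (s₁ i, s₂ i))
    (fun s₁ s₂ => Finset.prod_nonneg fun i _ => ch.WS_mem.1 _)
    (A₁ := fun s b => ∏ i, A₁ (s i) (b i)) (fun s => pi_mem_stdSimplex fun i => hA₁ (s i))
    (A₂ := fun s b => ∏ i, A₂ (s i) (b i)) (fun s => pi_mem_stdSimplex fun i => hA₂ (s i))
    (N := fun b₁ b₂ s₁ s₂ y => ∏ i, ch.W (b₁ i).2 (b₂ i).2 (s₁ i) (s₂ i) (y i))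
    (fun b₁ b₂ s₁ s₂ => pi_mem_stdSimplex fun i => ch.W_mem _ _ _ _) hPm
    (fun ω i => (ω i).s₁) (fun ω i => (ω i).s₂) (fun ω i => ((ω i).u₁, (ω i).x₁))
    (fun ω i => ((ω i).u₂, (ω i).x₂)) (fun ω i => (ω i).y)
    (by exact hfac) (fun b i => (b i).1) (fun b i => (b i).1)
    (fun s b => τ.1 + ε < (∑ i, ch.κ₁ (b i).2 (s i)) / n)
    (fun s b => τ.2 + ε < (∑ i, ch.κ₂ (b i).2 (s i)) / n)
    -- `t₀` lies just below the typical conditional probability of the sum given the output, `t₁`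
    -- and `t₂` just above those of the auxiliary words given the states.
    (t₀ := 2 ^ (-(n * (H₀ + ε)))) (t₁ := 2 ^ (-(n * (H₁ - ε)))) (t₂ := 2 ^ (-(n * (H₂ - ε))))
    (by positivity) (by positivity) (by positivity)
  have b₁ : (∑ ω, P ω * if τ.1 + ε < (∑ i, ch.κ₁ (ω i).x₁ (ω i).s₁) / n then 1 else 0) ≤
      expect p (fun ω => (Z₁ ω - expect p Z₁) ^ 2) / ε ^ 2 / n := by
    refine le_trans (Finset.sum_le_sum fun ω _ => mul_le_mul_of_nonneg_left ?_ (hPm.1 ω))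
      (upper_tail_le h.pmf Z₁ hn hε)
    by_cases hlt : τ.1 + ε < (∑ i, ch.κ₁ (ω i).x₁ (ω i).s₁) / n
    · rw [lt_div_iff₀ hn', mul_comm] at hlt
      rw [if_pos (lt_of_le_of_lt (mul_le_mul_of_nonneg_left
        (add_le_add h.cost₁ le_rfl) hn'.le) hlt)]
      split_ifs <;> norm_num
    · rw [if_neg hlt]
      split_ifs <;> norm_num
  have b₂ : (∑ ω, P ω * if τ.2 + ε < (∑ i, ch.κ₂ (ω i).x₂ (ω i).s₂) / n then 1 else 0) ≤
      expect p (fun ω => (Z₂ ω - expect p Z₂) ^ 2) / ε ^ 2 / n := by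
    refine le_trans (Finset.sum_le_sum fun ω _ => mul_le_mul_of_nonneg_left ?_ (hPm.1 ω))
      (upper_tail_le h.pmf Z₂ hn hε)
    by_cases hlt : τ.2 + ε < (∑ i, ch.κ₂ (ω i).x₂ (ω i).s₂) / n
    · rw [lt_div_iff₀ hn', mul_comm] at hlt
      rw [if_pos (lt_of_le_of_lt (mul_le_mul_of_nonneg_left
        (add_le_add h.cost₂ le_rfl) hn'.le) hlt)]
      split_ifs <;> norm_num
    · rw [if_neg hlt]
      split_ifs <;> norm_num
  have b₃ := law_pi_lt_le h.pmf (fun ω => ω.u₁ + ω.u₂) (fun ω => ω.y) hn hε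
  have b₄ := lt_prod_condLaw_le h.pmf (fun ω => ω.u₁) (fun ω => ω.s₁) hn hε
  have b₅ := lt_prod_condLaw_le h.pmf (fun ω => ω.u₂) (fun ω => ω.s₂) hn hε
  have e₃ : ∀ ω : Fin n → Outcome V S₁ S₂ X₁ X₂ Y,
      law P (fun ω => ((fun i => (ω i).u₁) + (fun i => (ω i).u₂), fun i => (ω i).y))
        ((fun i => (ω i).u₁) + (fun i => (ω i).u₂), fun i => (ω i).y) =
      ∏ i, law p (fun ω => (ω.u₁ + ω.u₂, ω.y)) ((ω i).u₁ + (ω i).u₂, (ω i).y) := by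
    intro ω
    rw [← law_pi (fun _ => p) (fun ω => (ω.u₁ + ω.u₂, ω.y))
      (fun i => ((ω i).u₁ + (ω i).u₂, (ω i).y))]
    exact law_comp_injective P
      (fun (ω : Fin n → Outcome V S₁ S₂ X₁ X₂ Y) i => ((ω i).u₁ + (ω i).u₂, (ω i).y))
      (f := fun z => (fun i => (z i).1, fun i => (z i).2))
      (fun z z' hz => funext fun i => Prod.ext (congrFun (congrArg Prod.fst hz) i)
        (congrFun (congrArg Prod.snd hz) i)) (fun i => ((ω i).u₁ + (ω i).u₂, (ω i).y))
  have e₃' : ∀ ω : Fin n → Outcome V S₁ S₂ X₁ X₂ Y, law P (fun ω i => (ω i).y)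
      (fun i => (ω i).y) = ∏ i, law p (fun ω => ω.y) (ω i).y := fun ω =>
    law_pi (fun _ => p) (fun ω => ω.y) fun i => (ω i).y
  -- Restricted to positive probability because `A₁` agrees with the conditional law only at states
  -- that occur.
  have e₄ : ∀ ω : Fin n → Outcome V S₁ S₂ X₁ X₂ Y, P ω ≠ 0 →
      law (fun b : Fin n → V × X₁ => ∏ i, A₁ (ω i).s₁ (b i)) (fun b i => (b i).1)
        (fun i => (ω i).u₁) =
      ∏ i, condLaw p (fun ω => ω.u₁) (fun ω => ω.s₁) (ω i).u₁ (ω i).s₁ := by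
    intro ω hω
    rw [law_pi (fun i => A₁ (ω i).s₁) Prod.fst fun i => (ω i).u₁]
    refine Finset.prod_congr rfl fun i _ => hm₁ _ (ne_of_gt (law_pos h.pmf.1 _ ?_)) _
    exact (h.pmf.1 _).lt_of_ne' fun h0 => hω (Finset.prod_eq_zero (Finset.mem_univ i) h0)
  have e₅ : ∀ ω : Fin n → Outcome V S₁ S₂ X₁ X₂ Y, P ω ≠ 0 →
      law (fun b : Fin n → V × X₂ => ∏ i, A₂ (ω i).s₂ (b i)) (fun b i => (b i).1)
        (fun i => (ω i).u₂) =
      ∏ i, condLaw p (fun ω => ω.u₂) (fun ω => ω.s₂) (ω i).u₂ (ω i).s₂ := by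
    intro ω hω
    rw [law_pi (fun i => A₂ (ω i).s₂) Prod.fst fun i => (ω i).u₂]
    refine Finset.prod_congr rfl fun i _ => hm₂ _ (ne_of_gt (law_pos h.pmf.1 _ ?_)) _
    exact (h.pmf.1 _).lt_of_ne' fun h0 => hω (Finset.prod_eq_zero (Finset.mem_univ i) h0)
  have a₃ : (∑ ω, P ω * if law P (fun ω => ((fun i => (ω i).u₁) + (fun i => (ω i).u₂),
      fun i => (ω i).y)) ((fun i => (ω i).u₁) + (fun i => (ω i).u₂), fun i => (ω i).y) <
      2 ^ (-(n * (H₀ + ε))) * law P (fun ω i => (ω i).y) (fun i => (ω i).y) then 1 else 0) ≤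
      expect p (fun ω => (I₀ ω - H₀) ^ 2) / ε ^ 2 / n := by
    simp only [e₃, e₃']
    exact b₃
  have a₄ : (∑ ω, P ω * if 2 ^ (-(n * (H₁ - ε))) < law (fun b : Fin n → V × X₁ =>
      ∏ i, A₁ (ω i).s₁ (b i)) (fun b i => (b i).1) (fun i => (ω i).u₁) then 1 else 0) ≤
      expect p (fun ω => (I₁ ω - H₁) ^ 2) / ε ^ 2 / n := by
    refine le_trans (le_of_eq (Finset.sum_congr rfl fun ω _ => ?_)) b₄
    by_cases h0 : P ω = 0
    · rw [h0, zero_mul, show ∏ i, p (ω i) = 0 from h0, zero_mul]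
    · rw [e₄ ω h0]
  have a₅ : (∑ ω, P ω * if 2 ^ (-(n * (H₂ - ε))) < law (fun b : Fin n → V × X₂ =>
      ∏ i, A₂ (ω i).s₂ (b i)) (fun b i => (b i).1) (fun i => (ω i).u₂) then 1 else 0) ≤
      expect p (fun ω => (I₂ ω - H₂) ^ 2) / ε ^ 2 / n := by
    refine le_trans (le_of_eq (Finset.sum_congr rfl fun ω _ => ?_)) b₅
    by_cases h0 : P ω = 0
    · rw [h0, zero_mul, show ∏ i, p (ω i) = 0 from h0, zero_mul]
    · rw [e₅ ω h0]
  have hcard : ((Fintype.card ((Fin l₀ → V) × (Fin l₁ → V) × (Fin l₂ → V)) : ℕ) : ℝ) =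
      (Fintype.card V : ℝ) ^ (l₀ + l₁ + l₂) := by
    simp only [Fintype.card_prod, Fintype.card_fun, Fintype.card_fin]
    push_cast
    ring
  have hcard₀ : ((Fintype.card (Fin l₀ → V) : ℕ) : ℝ) = (Fintype.card V : ℝ) ^ l₀ := by
    simp
  have ht₀ : 1 / ((2 : ℝ) ^ (-(n * (H₀ + ε))) * (Fintype.card V : ℝ) ^ l₀) =
      2 ^ (n * (H₀ + ε)) / (Fintype.card V : ℝ) ^ l₀ := by
    rw [Real.rpow_neg (by norm_num)]
    field_simp
  rw [hcard, hcard₀, ht₀] at hcode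
  refine ch.exists_code_of_maps hn (fun m s i => (f₁ m s i).2)
    (fun m s i => (f₂ m s i).2) dec (add_nonneg hτ₁ hε.le) (add_nonneg hτ₂ hε.le) hK hK₁ hK₂ ?_
  refine (le_of_eq ?_).trans (hcode.trans (mul_le_mul_of_nonneg_left
    (le_trans (add_le_add (add_le_add (add_le_add (add_le_add ((le_of_eq ?_).trans b₁)
      ((le_of_eq ?_).trans b₂)) a₃) le_rfl) (mul_le_mul_of_nonneg_left
      (add_le_add (add_le_add (add_le_add (mul_le_mul_of_nonneg_left a₄ zero_le_two) le_rfl)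
        (mul_le_mul_of_nonneg_left a₅ zero_le_two)) le_rfl) zero_le_three))
      ((le_of_eq ?_).trans hE)) (by positivity)))
  · congr! 11
  · congr!
  · congr!
  · rw [hC]
    ring

open Filter Topology in
-- The bound of `IsTestChannel.exists_block_code` once dimensions are chosen; 6 is 3 for each of the
-- two users.
theorem tendsto_error_bound (C : ℝ) {ε : ℝ} (hε : 0 < ε) :
    Tendsto (fun n : ℕ => C / n + (2 : ℝ) ^ (-(n * ε)) + 6 * √((2 : ℝ) ^ (-(n * ε)))) atTop
      (𝓝 0) := by
  have h : Tendsto (fun n : ℕ => (2 : ℝ) ^ (-(n * ε))) atTop (𝓝 0) := by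
    have e : (fun n : ℕ => (2 : ℝ) ^ (-(n * ε))) = fun n => ((2 : ℝ) ^ (-ε)) ^ n := by
      ext n
      rw [← Real.rpow_mul_natCast (by norm_num)]
      ring_nf
    rw [e]
    exact tendsto_pow_atTop_nhds_zero_of_lt_one (by positivity)
      (Real.rpow_lt_one_of_one_lt_of_neg (by norm_num) (by linarith))
  have h' := (Real.continuous_sqrt.tendsto 0).comp h
  rw [Real.sqrt_zero] at h'
  simpa using ((tendsto_const_div_atTop_nhds_zero_nat C).add h).add (h'.const_mul 6)

theorem MACDSTx.exists_cost_bound {S₁ S₂ X₁ X₂ Y : Type*} [Fintype S₁] [Fintype S₂]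
    [Fintype X₁] [Fintype X₂] [Fintype Y] (ch : MACDSTx S₁ S₂ X₁ X₂ Y) :
    ∃ K : ℝ, 0 ≤ K ∧ (∀ x s, ch.κ₁ x s ≤ K) ∧ ∀ x s, ch.κ₂ x s ≤ K := by
  have n₁ : 0 ≤ ∑ i : X₁ × S₁, ch.κ₁ i.1 i.2 := Finset.sum_nonneg fun i _ => ch.κ₁_nonneg _ _
  have n₂ : 0 ≤ ∑ i : X₂ × S₂, ch.κ₂ i.1 i.2 := Finset.sum_nonneg fun i _ => ch.κ₂_nonneg _ _
  refine ⟨_, add_nonneg n₁ n₂, fun x s => le_add_of_le_of_nonneg ?_ n₂, fun x s =>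
    le_add_of_nonneg_of_le n₁ ?_⟩
  · exact Finset.single_le_sum (f := fun i : X₁ × S₁ => ch.κ₁ i.1 i.2)
      (fun i _ => ch.κ₁_nonneg _ _) (Finset.mem_univ (x, s))
  · exact Finset.single_le_sum (f := fun i : X₂ × S₂ => ch.κ₂ i.1 i.2)
      (fun i _ => ch.κ₂_nonneg _ _) (Finset.mem_univ (x, s))

section

variable {S₁ S₂ X₁ X₂ Y : Type*} [Fintype S₁] [Fintype S₂] [Fintype X₁] [Fintype X₂] [Fintype Y]

/-- Strict inequality leaves room for the `ε`-margins and for rounding the dimensions: `l₀` is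
chosen for entropy `H₀ + 2ε`, and `l₁`, `l₂` for the rates. -/
theorem IsTestChannel.achievable_of_lt {V : Type*} [Field V] [Fintype V]
    {ch : MACDSTx S₁ S₂ X₁ X₂ Y} {τ : ℝ × ℝ} {p : Outcome V S₁ S₂ X₁ X₂ Y → ℝ}
    (h : IsTestChannel ch τ p) (hτ₁ : 0 ≤ τ.1) (hτ₂ : 0 ≤ τ.2) {R : ℝ × ℝ} (hR₁ : 0 ≤ R.1)
    (hR₂ : 0 ≤ R.2)
    (hR : R.1 + R.2 < min (condEntropy p (fun ω => ω.u₁) (fun ω => ω.s₁))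
        (condEntropy p (fun ω => ω.u₂) (fun ω => ω.s₂)) -
      condEntropy p (fun ω => ω.u₁ + ω.u₂) (fun ω => ω.y)) : ch.Achievable R τ := by
  refine ⟨hR₁, hR₂, hτ₁, hτ₂, fun η hη => ?_⟩
  have hH₀ := condEntropy_nonneg h.pmf.1 (fun ω => ω.u₁ + ω.u₂) (fun ω => ω.y)
  set H₀ := condEntropy p (fun ω => ω.u₁ + ω.u₂) (fun ω => ω.y)
  set H₁ := condEntropy p (fun ω => ω.u₁) (fun ω => ω.s₁)
  set H₂ := condEntropy p (fun ω => ω.u₂) (fun ω => ω.s₂)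
  set gap := min H₁ H₂ - H₀ - R.1 - R.2 with hgap
  have hgap0 : 0 < gap := by linarith
  -- Of the `8ε` available, `4ε` pays for the entropy margins and `4ε` for the roundings; `ε ≤ η /
  -- 2` is half of the cost slack.
  set ε := min (gap / 8) (η / 2) with hεdef
  have hε : 0 < ε := lt_min (by linarith) (by linarith)
  have hεg : ε ≤ gap / 8 := min_le_left _ _
  have hεη : ε ≤ η / 2 := min_le_right _ _
  obtain ⟨K, hK, hK₁, hK₂⟩ := ch.exists_cost_bound
  obtain ⟨C, hC⟩ := h.exists_block_code hτ₁ hτ₂ hε hK hK₁ hK₂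
  set q : ℝ := (Fintype.card V : ℝ) with hq
  have hq1 : 1 < q := by
    rw [hq]
    exact_mod_cast Fintype.one_lt_card (α := V)
  set lam := Real.logb 2 q with hlam
  have hlam0 : 0 < lam := Real.logb_pos (by norm_num) hq1
  have hqpow : ∀ l : ℕ, q ^ l = (2 : ℝ) ^ (lam * l) := by
    intro l
    rw [Real.rpow_mul_natCast (by norm_num), hlam, Real.rpow_logb (by norm_num) (by norm_num)
      (by linarith)]
  -- Makes `K * E` at most the other half of the cost slack; `K + 1` avoids dividing by zero.
  set E := min η (η / 2 / (K + 1)) with hE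
  have hE0 : 0 < E := lt_min hη (by positivity)
  have hKE : K * E ≤ η / 2 := by
    calc K * E ≤ (K + 1) * (η / 2 / (K + 1)) :=
          mul_le_mul (by linarith) (min_le_right _ _) hE0.le (by linarith)
      _ = η / 2 := by field_simp
  obtain ⟨N₁, hN₁⟩ := Filter.eventually_atTop.1
    ((tendsto_error_bound C hε).eventually (eventually_le_nhds hE0))
  -- Each of the three ceilings costs up to `lam` bits in total, not per letter.
  obtain ⟨N₂, hN₂⟩ := exists_nat_ge (3 * lam / (4 * ε))
  refine ⟨max N₁ N₂, fun n hn => ?_⟩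
  have hnN₁ : N₁ ≤ n := (le_max_left _ _).trans hn.le
  have hnN₂ : (N₂ : ℝ) ≤ n := by exact_mod_cast (le_max_right _ _).trans hn.le
  have hn0 : 0 < n := lt_of_le_of_lt (Nat.zero_le _) hn
  have hn' : (0 : ℝ) < n := by exact_mod_cast hn0
  have h3 : 3 * lam ≤ n * (4 * ε) := by
    rw [div_le_iff₀ (by positivity)] at hN₂
    exact hN₂.trans (mul_le_mul_of_nonneg_right hnN₂ (by positivity))
  set l₀ := ⌈n * (H₀ + 2 * ε) / lam⌉₊
  set l₁ := ⌈n * R.1 / lam⌉₊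
  set l₂ := ⌈n * R.2 / lam⌉₊
  have ceil_ge : ∀ x : ℝ, x ≤ lam * ⌈x / lam⌉₊ := fun x => by
    rw [← div_le_iff₀' hlam0]; exact Nat.le_ceil _
  have ceil_le : ∀ x : ℝ, 0 ≤ x → lam * ⌈x / lam⌉₊ ≤ x + lam := fun x hx => by
    calc lam * ⌈x / lam⌉₊ ≤ lam * (x / lam + 1) :=
          mul_le_mul_of_nonneg_left (Nat.ceil_lt_add_one (by positivity)).le hlam0.le
      _ = x + lam := by field_simp
  have g₀ := ceil_ge (n * (H₀ + 2 * ε))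
  have g₁ := ceil_ge (n * R.1)
  have g₂ := ceil_ge (n * R.2)
  have u₀ := ceil_le (n * (H₀ + 2 * ε)) (by positivity)
  have u₁ := ceil_le (n * R.1) (by positivity)
  have u₂ := ceil_le (n * R.2) (by positivity)
  have hsum : lam * ((l₀ + l₁ + l₂ : ℕ) : ℝ) ≤ n * (min H₁ H₂ - 2 * ε) := by
    have : min H₁ H₂ = gap + H₀ + R.1 + R.2 := by rw [hgap]; ring
    rw [this]
    have h8 : n * (8 * ε) ≤ n * gap := mul_le_mul_of_nonneg_left (by linarith) hn'.le
    push_cast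
    linarith
  have hterm : ∀ H, min H₁ H₂ ≤ H →
      √(q ^ (l₀ + l₁ + l₂) * 2 ^ (-(n * (H - ε)))) ≤ √((2 : ℝ) ^ (-(n * ε))) := by
    intro H hH
    refine Real.sqrt_le_sqrt ?_
    rw [hqpow, ← Real.rpow_add (by norm_num)]
    refine Real.rpow_le_rpow_of_exponent_le (by norm_num) ?_
    have : n * min H₁ H₂ ≤ n * H := mul_le_mul_of_nonneg_left hH hn'.le
    linarith
  have hterm₀ : (2 : ℝ) ^ (n * (H₀ + ε)) / q ^ l₀ ≤ 2 ^ (-(n * ε)) := by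
    rw [hqpow, ← Real.rpow_sub (by norm_num)]
    refine Real.rpow_le_rpow_of_exponent_le (by norm_num) ?_
    linarith
  obtain ⟨c, hc⟩ := hC n l₀ l₁ l₂ E hn0 (by
    have := hN₁ n hnN₁
    have := hterm H₁ (min_le_left _ _)
    have := hterm H₂ (min_le_right _ _)
    linarith)
  have hrate : ∀ (r : ℝ) (l : ℕ), n * r ≤ lam * l →
      r - η ≤ Real.logb 2 ((Fintype.card (Fin l → V) : ℕ) : ℝ) / n := by
    intro r l hl
    have : ((Fintype.card (Fin l → V) : ℕ) : ℝ) = q ^ l := by simp [hq]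
    rw [this, Real.logb_pow, le_div_iff₀ hn']
    nlinarith
  exact ⟨_, _, c, Fintype.card_pos, Fintype.card_pos, hrate _ _ g₁, hrate _ _ g₂,
    hc.1.trans (min_le_left _ _), by linarith [hc.2.1], by linarith [hc.2.2]⟩

/-- With one message per user nothing can be decoded wrongly, and sending the cheapest input for
each state letter costs no more on average than the test channel does. -/
theorem IsTestChannel.achievable_zero {U : Type*} [Fintype U] {ch : MACDSTx S₁ S₂ X₁ X₂ Y}
    {τ : ℝ × ℝ} {p : Outcome U S₁ S₂ X₁ X₂ Y → ℝ} (h : IsTestChannel ch τ p) (hτ₁ : 0 ≤ τ.1)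
    (hτ₂ : 0 ≤ τ.2) : ch.Achievable (0, 0) τ := by
  have hne : Nonempty (Outcome U S₁ S₂ X₁ X₂ Y) := by
    by_contra! hne
    simpa using h.pmf.2
  have : Nonempty X₁ := hne.map fun ω => ω.x₁
  have : Nonempty X₂ := hne.map fun ω => ω.x₂
  choose f₁ hf₁ using fun s => Finite.exists_min fun x => ch.κ₁ x s
  choose f₂ hf₂ using fun s => Finite.exists_min fun x => ch.κ₂ x s
  have hs : ∀ φ : S₁ × S₂ → ℝ, ∑ s, ch.WS s * φ s = ∑ ω, p ω * φ ω.s := by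
    intro φ
    rw [← sum_law_mul p (fun ω => ω.s) φ]
    exact Finset.sum_congr rfl fun s _ => by rw [h.state]
  have c₁ : ∑ s, ch.WS₁ s * ch.κ₁ (f₁ s) s ≤ τ.1 := by
    refine le_trans (le_of_eq ?_) ((Finset.sum_le_sum fun ω _ =>
      mul_le_mul_of_nonneg_left (hf₁ ω.s₁ ω.x₁) (h.pmf.1 ω)).trans h.cost₁)
    rw [← hs fun s => ch.κ₁ (f₁ s.1) s.1, Fintype.sum_prod_type]
    simp only [MACDSTx.WS₁, Finset.sum_mul]
  have c₂ : ∑ s, ch.WS₂ s * ch.κ₂ (f₂ s) s ≤ τ.2 := by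
    refine le_trans (le_of_eq ?_) ((Finset.sum_le_sum fun ω _ =>
      mul_le_mul_of_nonneg_left (hf₂ ω.s₂ ω.x₂) (h.pmf.1 ω)).trans h.cost₂)
    rw [← hs fun s => ch.κ₂ (f₂ s.2) s.2, Fintype.sum_prod_type, Finset.sum_comm]
    simp only [MACDSTx.WS₂, Finset.sum_mul]
  refine ⟨le_rfl, le_rfl, hτ₁, hτ₂, fun η hη => ⟨0, fun n hn => ⟨1, 1,
    ⟨fun _ s i => f₁ (s i), fun _ s i => f₂ (s i), fun _ => (0, 0)⟩, one_pos, one_pos,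
    by simp [hη.le], by simp [hη.le], ?_, ?_, ?_⟩⟩⟩
  · have : ∀ m : Fin 1 × Fin 1, ((0 : Fin 1), (0 : Fin 1)) = m := fun _ => Subsingleton.elim _ _
    simp [MACDSTx.avgErrorProb, MACDSTx.errorProb, hη.le]
  all_goals have hn' : (0 : ℝ) < n := by exact_mod_cast hn
  · have e := sum_pi_mul_sum ch.WS₁_mem (fun s => ch.κ₁ (f₁ s) s) n
    simp only [MACDSTx.avgCost₁, MACDSTx.cost₁, ← mul_div_assoc, ← Finset.sum_div, e,
      Finset.univ_unique, Finset.sum_singleton, Nat.cast_one, div_one]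
    rw [mul_div_cancel_left₀ _ hn'.ne']
    linarith
  · have e := sum_pi_mul_sum ch.WS₂_mem (fun s => ch.κ₂ (f₂ s) s) n
    simp only [MACDSTx.avgCost₂, MACDSTx.cost₂, ← mul_div_assoc, ← Finset.sum_div, e,
      Finset.univ_unique, Finset.sum_singleton, Nat.cast_one, div_one]
    rw [mul_div_cancel_left₀ _ hn'.ne']
    linarith

end

end

/-! ### Passage to the closed convex hull. -/

theorem theorem4 {S₁ S₂ X₁ X₂ Y : Type*} [Fintype S₁] [Fintype S₂] [Fintype X₁] [Fintype X₂]
    [Fintype Y] (ch : MACDSTx S₁ S₂ X₁ X₂ Y) (τ : ℝ × ℝ) (hτ₁ : 0 ≤ τ.1) (hτ₂ : 0 ≤ τ.2) :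
    betaF ch τ ⊆ ch.capacityRegion τ := by
  -- The capacity region is closed and convex, so it suffices to place the generating pairs in it.
  refine closure_minimal (convexHull_min ?_ (convex_convexHull ℝ _).closure) isClosed_closure
  rintro R ⟨V, _, _, p, hp, hR₁, hR₂, hR⟩
  -- Scaling by `t < 1` makes the rate bound strict only for a nonzero sum rate, so the zero pair is
  -- treated separately; otherwise `R` is the limit of the achievable pairs `t • R`.
  rcases (add_nonneg hR₁ hR₂).eq_or_lt with h0 | hpos
  · have e₁ : R.1 = 0 := by linarith
    have e₂ : R.2 = 0 := by linarith
    have : R = (0, 0) := Prod.ext e₁ e₂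
    rw [this]
    exact subset_closure (subset_convexHull ℝ _ (hp.achievable_zero hτ₁ hτ₂))
  · have ht : Filter.Tendsto (fun t : ℝ => t • R) (nhdsWithin 1 (Set.Iio 1)) (nhds R) := by
      have : Filter.Tendsto (fun t : ℝ => t • R) (nhds 1) (nhds ((1 : ℝ) • R)) :=
        (continuous_id.smul continuous_const).tendsto 1
      rw [one_smul] at this
      exact this.mono_left nhdsWithin_le_nhds
    refine mem_closure_of_tendsto ht ?_
    filter_upwards [Ico_mem_nhdsLT (show (0 : ℝ) < 1 by norm_num)] with t ht
    refine subset_convexHull ℝ _ (hp.achievable_of_lt hτ₁ hτ₂ (mul_nonneg ht.1 hR₁)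
      (mul_nonneg ht.1 hR₂) (lt_of_lt_of_le ?_ hR))
    change t * R.1 + t * R.2 < _
    rw [← mul_add]
    exact mul_lt_of_lt_one_left hpos ht.2
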